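/- **Setting.** Let $p,q\in\mathbb N$, let $v\sim P_v$ and $w\sim P_w$ be random variables, let $f_v:\mathbb R^q\to\mathbb R$ and $g_w:\mathbb R^p\to\mathbb R^q$ be differentiable functions depending measurably on $v$, $w$, with $g_w(x)$ integrable for every $x$, and put $$g(x)=\mathbb E_w[g_w(x)],\qquad \mathcal J(x)=\mathbb E_v\big[f_v(g(x))\big].$$ Assume, for all $v,w$ and all arguments, that $|f_v(y)|\le B_f$, $\|\nabla f_v(y)\|_2\le M_f$, $\|\nabla f_v(y_1)-\nabla f_v(y_2)\|_2\le L_f\|y_1-y_2\|_2$, $\|g_w(x_1)-g_w(x_2)\|_2\le M_g\|x_1-x_2\|_2$ and $\|\nabla g_w(x_1)-\nabla g_w(x_2)\|_2\le L_g\|x_1-x_2\|_2$ (spectral norm of Jacobians). **Oracles.** A call to $\mathrm{Oracle}_f$ at $y$ returns $\nabla f_v(y)$, and a call to $\mathrm{Oracle}_g$ at $x$ returns $g_w(x)$ or the Jacobian $\nabla g_w(x)$, for a freshly sampled random index $v$ or $w$. All samples are independent, and for every fixed query point the answers are unbiased estimates of $\mathbb E_v[\nabla f_v(y)]$, $\mathbb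 E_w[\nabla g_w(x)]$, $\mathbb E_w[g_w(x)]$ with variances at most $\sigma_1^2,\sigma_2^2,\sigma_3^2$ respectively. **Algorithm (C-ADAM).** Given $\epsilon>0$, an initial point $x_1$ and a number $T\ge1$ of iterations, set $z_1=x_1$, $y_1=0$, $m_0=v_0=0$. For $t=1,\dots,T$: let $\overline{\nabla g_t}(x_t)$ be the mean of $K^{(1)}_t$ Jacobians obtained from $\mathrm{Oracle}_g$ at $x_t$ and $\overline{\nabla f_t}(y_t)$ the mean of $K_t^{(2)}$ gradients obtained from $\mathrm{Oracle}_f$ at $y_t$; put $d_t=\overline{\nabla g_t}(x_t)^{\mathsf T}\,\overline{\nabla f_t}(y_t)$ and, with coordinatewise operations, $$m_t=\gamma_t^{(1)}m_{t-1}+(1-\gamma_t^{(1)})d_t,\quad v_t=\gamma_t^{(2)}v_{t-1}+(1-\gamma_t^{(2)})d_t^2,\quad x_{t+1}=x_t-\alpha_t\frac{m_t}{\sqrt{v_t}+\epsilon},$$ $$z_{t+1}=\Big(1-\frac1{\beta_t}\Big)x_t+\frac1{\beta_t}x_{t+1},\qquad y_{t+1}=(1-\beta_t)y_t+\beta_t\,\overline{g_t}(z_{t+1}),$$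 where $\overline{g_t}(z_{t+1})$ is the mean of $K_t^{(3)}$ values obtained from $\mathrm{Oracle}_g$ at $z_{t+1}$. The output $\tilde x$ is drawn uniformly from $\{x_1,\dots,x_T\}$, independently of everything else. (A square root of a negative number, which can occur only if some $\gamma^{(2)}_t<0$, is read as $0$.) **Theorem.** Let $$\alpha_t=\frac{C_\alpha}{t^{1/5}},\quad \beta_t=C_\beta,\quad K_t^{(i)}=\lceil C_i\,t^{4/5}\rceil\ (i=1,2,3),\quad \gamma^{(1)}_t=C_\gamma\mu^t,\quad \gamma_t^{(2)}=1-\frac{C_\alpha}{t^{2/5}}(1-C_\gamma\mu^t)^2$$ with constants $C_\alpha,C_\beta,C_1,C_2,C_3,C_\gamma,\mu>0$ such that $C_\beta<1$ and $\mu<1$. Then $\mathcal J$ is differentiable, and there is a constant $C$, depending only on $p$, $q$, $B_f$, $M_f$, $L_f$, $M_g$, $L_g$, $\sigma_1,\sigma_2,\sigma_3$, $\epsilon$, the constants of the schedule and an upper bound $R$ for $\|g(x_1)\|_2$, such that for every $\delta\in(0,1)$ there is a number $T\ge1$ of iterations (depending only on $\delta$ and the same quantities) for which the output of C-ADAM is,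 in expectation, a $\delta$-approximate first-order stationary point of $\mathcal J$, $$\mathbb E_{\rm total}\big[\|\nabla\mathcal J(\tilde x)\|_2^2\big]\le\delta,$$ where the expectation is over all the randomness, and the total number of calls to $\mathrm{Oracle}_f$ and $\mathrm{Oracle}_g$ satisfies $$\sum_{t=1}^T\big(K_t^{(1)}+K_t^{(2)}+K_t^{(3)}\big)\le C\,\delta^{-9/4}.$$ -/

import Mathlib

open MeasureTheory ProbabilityTheory

universe u

namespace CAdam

/-- The inner map `g(x) = E_w [g_w(x)]`. -/
noncomputable def innerMap {p q : ℕ} {W : Type u} [MeasurableSpace W] (Pw : Measure W)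
    (g : W → EuclideanSpace ℝ (Fin p) → EuclideanSpace ℝ (Fin q))
    (x : EuclideanSpace ℝ (Fin p)) : EuclideanSpace ℝ (Fin q) :=
  ∫ w, g w x ∂Pw

/-- The compositional objective `J(x) = E_v [f_v (E_w [g_w(x)])]`. -/
noncomputable def objective {p q : ℕ} {V W : Type u} [MeasurableSpace V] [MeasurableSpace W]
    (Pv : Measure V) (Pw : Measure W) (f : V → EuclideanSpace ℝ (Fin q) → ℝ)
    (g : W → EuclideanSpace ℝ (Fin p) → EuclideanSpace ℝ (Fin q))
    (x : EuclideanSpace ℝ (Fin p)) : ℝ :=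
  ∫ v, f v (innerMap Pw g x) ∂Pv

/-- The regularity assumptions on the functions `f_v` and `g_w`. The norm of a Jacobian is the
operator norm between Euclidean spaces, i.e. the spectral norm of the Jacobian matrix. -/
structure Regular {p q : ℕ} {V W : Type u} [MeasurableSpace V] [MeasurableSpace W]
    (Pw : Measure W) (f : V → EuclideanSpace ℝ (Fin q) → ℝ)
    (g : W → EuclideanSpace ℝ (Fin p) → EuclideanSpace ℝ (Fin q))
    (Bf Mf Lf Mg Lg : ℝ) : Prop where
  measurable_f : ∀ y, Measurable fun v => f v y
  measurable_g : ∀ x, Measurable fun w => g w x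
  integrable_g : ∀ x, Integrable (fun w => g w x) Pw
  differentiable_f : ∀ v, Differentiable ℝ (f v)
  differentiable_g : ∀ w, Differentiable ℝ (g w)
  bounded_f : ∀ v y, |f v y| ≤ Bf
  bounded_grad_f : ∀ v y, ‖gradient (f v) y‖ ≤ Mf
  smooth_f : ∀ v y₁ y₂, ‖gradient (f v) y₁ - gradient (f v) y₂‖ ≤ Lf * ‖y₁ - y₂‖
  lipschitz_g : ∀ w x₁ x₂, ‖g w x₁ - g w x₂‖ ≤ Mg * ‖x₁ - x₂‖
  smooth_g : ∀ w x₁ x₂, ‖fderiv ℝ (g w) x₁ - fderiv ℝ (g w) x₂‖ ≤ Lg * ‖x₁ - x₂‖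

/-- The random indices behind the oracle answers. At iteration `t` the `j`-th answer of
`Oracle_g` at the point `x_t` is the Jacobian of `g_w` for `w = jac t j`, the `j`-th answer of
`Oracle_f` at the point `y_t` is the gradient of `f_v` for `v = grad t j`, and the `j`-th answer
of `Oracle_g` at the point `z_{t+1}` is the value of `g_w` for `w = val t j`. -/
structure Samples (Ω V W : Type u) where
  jac : ℕ → ℕ → Ω → W
  grad : ℕ → ℕ → Ω → V
  val : ℕ → ℕ → Ω → W

/-- Labels of the single oracle calls: the kind of call, the iteration, the place in the batch. -/
inductive Call
  | jac (t j : ℕ)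
  | grad (t j : ℕ)
  | val (t j : ℕ)

/-- The σ-algebra generated by the random index used in one oracle call. -/
@[reducible]
def Samples.sigma {Ω V W : Type u} [mV : MeasurableSpace V] [mW : MeasurableSpace W]
    (S : Samples Ω V W) : Call → MeasurableSpace Ω
  | .jac t j => mW.comap (S.jac t j)
  | .grad t j => mV.comap (S.grad t j)
  | .val t j => mW.comap (S.val t j)

/-- The oracle assumptions: all samples are independent, and at every fixed query point the
answers are unbiased with variance at most `σ₁²` (gradients of `f`), `σ₂²` (Jacobians of `g`),
`σ₃²` (values of `g`). The variances are Lebesgue integrals, so that the bounds also say that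
the second moments are finite. -/
structure UnbiasedBoundedVariance {p q : ℕ} {Ω V W : Type u} [MeasurableSpace Ω]
    [MeasurableSpace V] [MeasurableSpace W] (P : Measure Ω) (Pv : Measure V) (Pw : Measure W)
    (f : V → EuclideanSpace ℝ (Fin q) → ℝ)
    (g : W → EuclideanSpace ℝ (Fin p) → EuclideanSpace ℝ (Fin q))
    (S : Samples Ω V W) (σ₁ σ₂ σ₃ : ℝ) : Prop where
  measurable_jac : ∀ t j, Measurable (S.jac t j)
  measurable_grad : ∀ t j, Measurable (S.grad t j)
  measurable_val : ∀ t j, Measurable (S.val t j)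
  indep : iIndep S.sigma P
  unbiased_grad : ∀ t j y,
    ∫ ω, gradient (f (S.grad t j ω)) y ∂P = ∫ v, gradient (f v) y ∂Pv
  unbiased_jac : ∀ t j x,
    ∫ ω, fderiv ℝ (g (S.jac t j ω)) x ∂P = ∫ w, fderiv ℝ (g w) x ∂Pw
  unbiased_val : ∀ t j z,
    ∫ ω, g (S.val t j ω) z ∂P = ∫ w, g w z ∂Pw
  variance_grad : ∀ t j y,
    ∫⁻ ω, ‖gradient (f (S.grad t j ω)) y - ∫ v, gradient (f v) y ∂Pv‖ₑ ^ 2 ∂P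
      ≤ ENNReal.ofReal (σ₁ ^ 2)
  variance_jac : ∀ t j x,
    ∫⁻ ω, ‖fderiv ℝ (g (S.jac t j ω)) x - ∫ w, fderiv ℝ (g w) x ∂Pw‖ₑ ^ 2 ∂P
      ≤ ENNReal.ofReal (σ₂ ^ 2)
  variance_val : ∀ t j z,
    ∫⁻ ω, ‖g (S.val t j ω) z - ∫ w, g w z ∂Pw‖ₑ ^ 2 ∂P
      ≤ ENNReal.ofReal (σ₃ ^ 2)

/-- The free parameters of the algorithm: step sizes, averaging weights, mini-batch sizes,
momentum weights and the constant `ε` in the denominator of the update. -/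
structure Params where
  α : ℕ → ℝ
  β : ℕ → ℝ
  K₁ : ℕ → ℕ
  K₂ : ℕ → ℕ
  K₃ : ℕ → ℕ
  γ₁ : ℕ → ℝ
  γ₂ : ℕ → ℝ
  ε : ℝ

/-- The parameter schedule of the theorem; mini-batch sizes are rounded up to integers. -/
noncomputable def schedule (ε Cα Cβ C₁ C₂ C₃ Cγ μ : ℝ) : Params where
  α t := Cα / (t : ℝ) ^ (1 / 5 : ℝ)
  β _ := Cβ
  K₁ t := ⌈C₁ * (t : ℝ) ^ (4 / 5 : ℝ)⌉₊
  K₂ t := ⌈C₂ * (t : ℝ) ^ (4 / 5 : ℝ)⌉₊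
  K₃ t := ⌈C₃ * (t : ℝ) ^ (4 / 5 : ℝ)⌉₊
  γ₁ t := Cγ * μ ^ t
  γ₂ t := 1 - Cα / (t : ℝ) ^ (2 / 5 : ℝ) * (1 - Cγ * μ ^ t) ^ 2
  ε := ε

/-- The number of single oracle calls (to `Oracle_g` and `Oracle_f` together) made in the
iterations `1, …, T`. -/
def Params.oracleCalls (A : Params) (T : ℕ) : ℕ :=
  ∑ t ∈ Finset.Icc 1 T, (A.K₁ t + A.K₂ t + A.K₃ t)

/-- The mean of a mini-batch of size `K`. -/
noncomputable def batchMean {E : Type*} [AddCommGroup E] [Module ℝ E] (K : ℕ) (F : ℕ → E) : E :=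
  (K : ℝ)⁻¹ • ∑ j ∈ Finset.range K, F j

/-- The variables `x_t, z_t, y_t, m_{t-1}, v_{t-1}` at the start of iteration `t`. -/
structure State (p q : ℕ) where
  x : EuclideanSpace ℝ (Fin p)
  z : EuclideanSpace ℝ (Fin p)
  y : EuclideanSpace ℝ (Fin q)
  m : EuclideanSpace ℝ (Fin p)
  v : EuclideanSpace ℝ (Fin p)

/-- Iteration `t` of the algorithm on the sample path `ω`. -/
noncomputable def step {p q : ℕ} {Ω V W : Type u} (A : Params)
    (f : V → EuclideanSpace ℝ (Fin q) → ℝ)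
    (g : W → EuclideanSpace ℝ (Fin p) → EuclideanSpace ℝ (Fin q))
    (S : Samples Ω V W) (ω : Ω) (t : ℕ) (s : State p q) : State p q :=
  let jacobian : EuclideanSpace ℝ (Fin p) →L[ℝ] EuclideanSpace ℝ (Fin q) :=
    batchMean (A.K₁ t) fun j => fderiv ℝ (g (S.jac t j ω)) s.x
  let grad : EuclideanSpace ℝ (Fin q) :=
    batchMean (A.K₂ t) fun j => gradient (f (S.grad t j ω)) s.y
  let d : EuclideanSpace ℝ (Fin p) := ContinuousLinearMap.adjoint jacobian grad
  let m : EuclideanSpace ℝ (Fin p) := A.γ₁ t • s.m + (1 - A.γ₁ t) • d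
  let v : EuclideanSpace ℝ (Fin p) :=
    WithLp.toLp 2 fun i => A.γ₂ t * s.v i + (1 - A.γ₂ t) * d i ^ 2
  let x : EuclideanSpace ℝ (Fin p) :=
    WithLp.toLp 2 fun i => s.x i - A.α t * (m i / (Real.sqrt (v i) + A.ε))
  let z : EuclideanSpace ℝ (Fin p) := (1 - 1 / A.β t) • s.x + (1 / A.β t) • x
  let y : EuclideanSpace ℝ (Fin q) :=
    (1 - A.β t) • s.y + A.β t • batchMean (A.K₃ t) fun j => g (S.val t j ω) z
  ⟨x, z, y, m, v⟩

/-- The state after the iterations `1, …, n`, started from `x_1 = z_1 = x₁`, `y_1 = 0`,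
`m_0 = v_0 = 0`. -/
noncomputable def run {p q : ℕ} {Ω V W : Type u} (A : Params)
    (f : V → EuclideanSpace ℝ (Fin q) → ℝ)
    (g : W → EuclideanSpace ℝ (Fin p) → EuclideanSpace ℝ (Fin q))
    (S : Samples Ω V W) (x₁ : EuclideanSpace ℝ (Fin p)) (ω : Ω) : ℕ → State p q
  | 0 => ⟨x₁, x₁, 0, 0, 0⟩
  | n + 1 => step A f g S ω (n + 1) (run A f g S x₁ ω n)

/-- The iterate `x_t`, for `t ≥ 1`. -/
noncomputable def iterate {p q : ℕ} {Ω V W : Type u} (A : Params)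
    (f : V → EuclideanSpace ℝ (Fin q) → ℝ)
    (g : W → EuclideanSpace ℝ (Fin p) → EuclideanSpace ℝ (Fin q))
    (S : Samples Ω V W) (x₁ : EuclideanSpace ℝ (Fin p)) (t : ℕ) (ω : Ω) :
    EuclideanSpace ℝ (Fin p) :=
  (run A f g S x₁ ω (t - 1)).x

/-- The law of all the randomness in a run with `T` iterations: the sample path, and an
independent uniform index in `{1, …, T}` that selects the output. -/
noncomputable def totalMeasure {Ω : Type u} [MeasurableSpace Ω] (P : Measure Ω) (T : ℕ) :
    Measure (Ω × ℕ) :=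
  P.prod (uniformOn (Set.Icc 1 T))

/-- The output: a uniformly random element of `x_1, …, x_T`. -/
noncomputable def output {p q : ℕ} {Ω V W : Type u} (A : Params)
    (f : V → EuclideanSpace ℝ (Fin q) → ℝ)
    (g : W → EuclideanSpace ℝ (Fin p) → EuclideanSpace ℝ (Fin q))
    (S : Samples Ω V W) (x₁ : EuclideanSpace ℝ (Fin p)) (r : Ω × ℕ) :
    EuclideanSpace ℝ (Fin p) :=
  iterate A f g S x₁ r.2 r.1

end CAdam

/-! Let F(y) = E_v[f_v(y)]. Differentiating under the integrals gives ∇J(x) = Dg(x)ᵀ ∇F(g(x)), which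
is bounded and Lipschitz. Along every run m_t and v_t are bounded by constants, so the Adam
denominators lie in a fixed interval [ε, D]. In each coordinate -mG/d ≤ ((m - G)² - G²)/(2d), so the
update decreases J up to the error ‖m_t - ∇J(x_t)‖² (`inner_step_le`). No unbiasedness of d_t is
needed here, which matters because d_t is a product evaluated at an inexact y_t.

Division by the step size, of order t^(-1/5), bounds ‖∇J(x_t)‖² by t^(1/5) times the decrease of J,
plus the error of m_t, plus O(t^(-4/5)) (`norm_gradient_sq_le_of_step`). The decreases sum to
O(T^(1/5)) by summation by parts, since J is bounded, and so does t^(-4/5). The remaining task is to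
show that the error of m_t is also of order t^(-4/5), in the summed and expected sense.

That error has three sources. Momentum contributes a geometrically small term, because the weights
are Cγ μ^t. The sampling errors of mini-batches of size of order t^(4/5) have second moments
O(t^(-4/5)); query points are random, but independent of the batch used there
(`lintegral_batchMean_random_le`). The tracking error y_t - g(x_t) contracts by 1 - β in mean
square: the extrapolated point z_{t+1} cancels the first-order drift of g, leaving ‖x_{t+1} - x_t‖⁴
= O(t^(-4/5)) and sampling noise (`norm_tracking_sq_le`).

Everything except the noise is estimated path by path (`exists_pathwise_bound`), and expectations
enter only in `exists_expected_sum_bound`. The mean squared gradient is thus at most c T^(-4/5), so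
T of order δ^(-5/4) suffices, and T^(9/5) oracle calls amount to order δ^(-9/4). -/

namespace CAdam

open Filter Topology

/-! ### Taylor remainders and derivative bounds. -/

section Calculus

variable {E F : Type*} [NormedAddCommGroup E] [NormedSpace ℝ E] [NormedAddCommGroup F]
  [NormedSpace ℝ F]

/-- The first-order Taylor remainder of a function with Lipschitz derivative is quadratic. -/
theorem norm_sub_sub_fderiv_le {f : E → F} {L : ℝ} (hL : 0 ≤ L) (hf : Differentiable ℝ f)
    (h : ∀ x y, ‖fderiv ℝ f x - fderiv ℝ f y‖ ≤ L * ‖x - y‖) (x y : E) :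
    ‖f y - f x - fderiv ℝ f x (y - x)‖ ≤ L * ‖y - x‖ ^ 2 := by
  -- The mean value inequality is applied on a ball where the derivative differs from its value at
  -- `x` by at most `L * ‖y - x‖`. This yields the constant `L` rather than `L / 2`, which affects
  -- only constants.
  have := Convex.norm_image_sub_le_of_norm_fderiv_le' (𝕜 := ℝ) (f := f)
    (s := Metric.closedBall x ‖y - x‖) (φ := fderiv ℝ f x) (C := L * ‖y - x‖) (x := x) (y := y)
    (fun z _ => hf z) (fun z hz => (h z x).trans (by
      gcongr
      simpa [dist_eq_norm] using hz)) (convex_closedBall _ _) (by simp)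
      (by simp [dist_eq_norm])
  calc _ ≤ L * ‖y - x‖ * ‖y - x‖ := this
    _ = _ := by ring

theorem norm_fderiv_le_of_norm_sub_le {f : E → F} {M : ℝ} (hM : 0 ≤ M)
    (h : ∀ x y, ‖f x - f y‖ ≤ M * ‖x - y‖) (x : E) : ‖fderiv ℝ f x‖ ≤ M :=
  norm_fderiv_le_of_lip' ℝ hM (Eventually.of_forall fun y => h y x)

theorem clm_eq_sum_smulRight {n : ℕ} (A : EuclideanSpace ℝ (Fin n) →L[ℝ] F) :
    A = ∑ i, (EuclideanSpace.proj i : EuclideanSpace ℝ (Fin n) →L[ℝ] ℝ).smulRight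
      (A (EuclideanSpace.single i 1)) := by
  ext x
  conv_lhs => rw [← (EuclideanSpace.basisFun (Fin n) ℝ).sum_repr x]
  simp

theorem norm_integral_fderiv_le {n : ℕ} {W : Type*} [MeasurableSpace W]
    {P : Measure W} [IsProbabilityMeasure P] {h : W → EuclideanSpace ℝ (Fin n) → F} {M : ℝ}
    (hM : ∀ w x, ‖fderiv ℝ (h w) x‖ ≤ M)
    (x : EuclideanSpace ℝ (Fin n)) : ‖∫ w, fderiv ℝ (h w) x ∂P‖ ≤ M := by
  simpa using norm_integral_le_of_norm_le_const (μ := P)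
    (Eventually.of_forall fun w => hM w x)

end Calculus

/-! ### Differentiation under the integral sign. -/

section Parametric

variable {n : ℕ} {W F : Type*} [MeasurableSpace W] [NormedAddCommGroup F] [NormedSpace ℝ F]
  [FiniteDimensional ℝ F] [MeasurableSpace F] [BorelSpace F]
  {h : W → EuclideanSpace ℝ (Fin n) → F}

/-- The directional derivative is a pointwise limit of difference quotients, each measurable in the
parameter. -/
theorem measurable_fderiv_apply_param (hm : ∀ x, Measurable fun w => h w x)
    (hd : ∀ w, Differentiable ℝ (h w)) (x e : EuclideanSpace ℝ (Fin n)) :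
    Measurable fun w => fderiv ℝ (h w) x e := by
  have : SecondCountableTopology F := by
    have := FiniteDimensional.proper ℝ F
    infer_instance
  refine measurable_of_tendsto_metrizable
    (f := fun k : ℕ => fun w => ((k : ℝ)) • (h w (x + (k : ℝ)⁻¹ • e) - h w x))
    (fun k => by fun_prop) (tendsto_pi_nhds.2 fun w => ?_)
  exact ((hd w x).hasFDerivAt).lim e (c := fun k : ℕ => (k : ℝ))
    (by simpa using tendsto_natCast_atTop_atTop (R := ℝ))

/-- A linear map on Euclidean space is assembled continuously from its columns, so directional
derivatives along the basis suffice. -/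
theorem measurable_fderiv_param (hm : ∀ x, Measurable fun w => h w x)
    (hd : ∀ w, Differentiable ℝ (h w)) (x : EuclideanSpace ℝ (Fin n)) :
    Measurable fun w => fderiv ℝ (h w) x := by
  have : SecondCountableTopology F := by
    have := FiniteDimensional.proper ℝ F
    infer_instance
  have h1 : (fun w => fderiv ℝ (h w) x) = fun w =>
      ∑ i, (EuclideanSpace.proj i : EuclideanSpace ℝ (Fin n) →L[ℝ] ℝ).smulRight
      (fderiv ℝ (h w) x (EuclideanSpace.single i 1)) :=
    funext fun w => clm_eq_sum_smulRight _
  have : SecondCountableTopology (EuclideanSpace ℝ (Fin n) →L[ℝ] F) := by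
    have := FiniteDimensional.proper ℝ (EuclideanSpace ℝ (Fin n) →L[ℝ] F)
    infer_instance
  rw [h1]
  refine Finset.measurable_sum _ fun i _ => ?_
  have hc : Continuous fun y : F =>
      (EuclideanSpace.proj i : EuclideanSpace ℝ (Fin n) →L[ℝ] ℝ).smulRight y :=
    ((ContinuousLinearMap.smulRightL ℝ (EuclideanSpace ℝ (Fin n)) F)
      (EuclideanSpace.proj i)).continuous
  exact hc.measurable.comp (measurable_fderiv_apply_param hm hd x _)

variable {P : Measure W} [IsProbabilityMeasure P] {M L : ℝ}

theorem integrable_fderiv_param (hm : ∀ x, Measurable fun w => h w x)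
    (hd : ∀ w, Differentiable ℝ (h w)) (hM : ∀ w x, ‖fderiv ℝ (h w) x‖ ≤ M)
    (x : EuclideanSpace ℝ (Fin n)) : Integrable (fun w => fderiv ℝ (h w) x) P := by
  have : SecondCountableTopology (EuclideanSpace ℝ (Fin n) →L[ℝ] F) := by
    have := FiniteDimensional.proper ℝ (EuclideanSpace ℝ (Fin n) →L[ℝ] F)
    infer_instance
  exact Integrable.of_bound (measurable_fderiv_param hm hd x).aestronglyMeasurable M
    (Eventually.of_forall fun w => hM w x)

theorem hasFDerivAt_integral_param (hm : ∀ x, Measurable fun w => h w x)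
    (hi : ∀ x, Integrable (fun w => h w x) P)
    (hd : ∀ w, Differentiable ℝ (h w)) (hM : ∀ w x, ‖fderiv ℝ (h w) x‖ ≤ M)
    (x : EuclideanSpace ℝ (Fin n)) :
    HasFDerivAt (fun x => ∫ w, h w x ∂P) (∫ w, fderiv ℝ (h w) x ∂P) x :=
  hasFDerivAt_integral_of_dominated_of_fderiv_le (bound := fun _ => M)
    (F := fun x w => h w x) (F' := fun x w => fderiv ℝ (h w) x) univ_mem
    (Eventually.of_forall fun x => (hi x).aestronglyMeasurable) (hi x)
    (integrable_fderiv_param hm hd hM x).aestronglyMeasurable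
    (Eventually.of_forall fun w x _ => hM w x) (integrable_const M)
    (Eventually.of_forall fun w x _ => (hd w x).hasFDerivAt)

theorem norm_integral_fderiv_sub_le (hm : ∀ x, Measurable fun w => h w x)
    (hd : ∀ w, Differentiable ℝ (h w)) (hM : ∀ w x, ‖fderiv ℝ (h w) x‖ ≤ M)
    (hL : ∀ w x y, ‖fderiv ℝ (h w) x - fderiv ℝ (h w) y‖ ≤ L * ‖x - y‖)
    (x y : EuclideanSpace ℝ (Fin n)) :
    ‖∫ w, fderiv ℝ (h w) x ∂P - ∫ w, fderiv ℝ (h w) y ∂P‖ ≤ L * ‖x - y‖ := by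
  rw [← integral_sub (integrable_fderiv_param hm hd hM x) (integrable_fderiv_param hm hd hM y)]
  simpa using norm_integral_le_of_norm_le_const (μ := P)
    (Eventually.of_forall fun w => hL w x y)

end Parametric

/-! ### Regularity of the objective and of the expected maps. -/

theorem inner_gradient {n : ℕ} (f : EuclideanSpace ℝ (Fin n) → ℝ)
    (x e : EuclideanSpace ℝ (Fin n)) : inner ℝ (gradient f x) e = fderiv ℝ f x e := by
  rw [← toDual_gradient, InnerProductSpace.toDual_apply_apply]

theorem norm_gradient_sub {n : ℕ} (f : EuclideanSpace ℝ (Fin n) → ℝ)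
    (x y : EuclideanSpace ℝ (Fin n)) :
    ‖gradient f x - gradient f y‖ = ‖fderiv ℝ f x - fderiv ℝ f y‖ := by
  rw [← toDual_gradient, ← toDual_gradient, ← map_sub, LinearIsometryEquiv.norm_map]

theorem norm_gradient {n : ℕ} (f : EuclideanSpace ℝ (Fin n) → ℝ)
    (x : EuclideanSpace ℝ (Fin n)) : ‖gradient f x‖ = ‖fderiv ℝ f x‖ := by
  rw [← toDual_gradient, LinearIsometryEquiv.norm_map]

/-- The expected gradient of the outer functions. -/
noncomputable def meanGrad {q : ℕ} {V : Type u} [MeasurableSpace V] (Pv : Measure V)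
    (f : V → EuclideanSpace ℝ (Fin q) → ℝ) (y : EuclideanSpace ℝ (Fin q)) :
    EuclideanSpace ℝ (Fin q) :=
  ∫ v, gradient (f v) y ∂Pv

/-- The expected Jacobian of the inner maps. -/
noncomputable def meanJac {p q : ℕ} {W : Type u} [MeasurableSpace W] (Pw : Measure W)
    (g : W → EuclideanSpace ℝ (Fin p) → EuclideanSpace ℝ (Fin q))
    (x : EuclideanSpace ℝ (Fin p)) : EuclideanSpace ℝ (Fin p) →L[ℝ] EuclideanSpace ℝ (Fin q) :=
  ∫ w, fderiv ℝ (g w) x ∂Pw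

/-- The Lipschitz constants may be negative when `p` or `q` is zero. Passing to absolute values
supplies the nonnegativity assumed in the estimates. -/
theorem Regular.abs {p q : ℕ} {V W : Type u} [MeasurableSpace V] [MeasurableSpace W]
    {Pw : Measure W} {f : V → EuclideanSpace ℝ (Fin q) → ℝ}
    {g : W → EuclideanSpace ℝ (Fin p) → EuclideanSpace ℝ (Fin q)} {Bf Mf Lf Mg Lg : ℝ}
    (hr : Regular Pw f g Bf Mf Lf Mg Lg) : Regular Pw f g |Bf| |Mf| |Lf| |Mg| |Lg| where
  measurable_f := hr.measurable_f
  measurable_g := hr.measurable_g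
  integrable_g := hr.integrable_g
  differentiable_f := hr.differentiable_f
  differentiable_g := hr.differentiable_g
  bounded_f v y := (hr.bounded_f v y).trans (le_abs_self _)
  bounded_grad_f v y := (hr.bounded_grad_f v y).trans (le_abs_self _)
  smooth_f v y₁ y₂ := (hr.smooth_f v y₁ y₂).trans (by gcongr; exact le_abs_self _)
  lipschitz_g w x₁ x₂ := (hr.lipschitz_g w x₁ x₂).trans (by gcongr; exact le_abs_self _)
  smooth_g w x₁ x₂ := (hr.smooth_g w x₁ x₂).trans (by gcongr; exact le_abs_self _)

/-- The error of `Aᵀ a` as an approximation of `Bᵀ b`. -/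
theorem norm_adjoint_apply_sub_le {p q : ℕ}
    (A B : EuclideanSpace ℝ (Fin p) →L[ℝ] EuclideanSpace ℝ (Fin q))
    (a b : EuclideanSpace ℝ (Fin q)) :
    ‖ContinuousLinearMap.adjoint A a - ContinuousLinearMap.adjoint B b‖
      ≤ ‖A - B‖ * ‖a‖ + ‖B‖ * ‖a - b‖ := by
  have : ContinuousLinearMap.adjoint A a - ContinuousLinearMap.adjoint B b =
      ContinuousLinearMap.adjoint (A - B) a + ContinuousLinearMap.adjoint B (a - b) := by
    simp
  rw [this]
  refine (norm_add_le _ _).trans (add_le_add ?_ ?_)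
  · rw [← LinearIsometryEquiv.norm_map ContinuousLinearMap.adjoint (A - B)]
    exact ContinuousLinearMap.le_opNorm _ _
  · rw [← LinearIsometryEquiv.norm_map ContinuousLinearMap.adjoint B]
    exact ContinuousLinearMap.le_opNorm _ _

namespace Regular

variable {p q : ℕ} {V W : Type u} [MeasurableSpace V] [MeasurableSpace W]
    {Pv : Measure V} {Pw : Measure W} {f : V → EuclideanSpace ℝ (Fin q) → ℝ}
    {g : W → EuclideanSpace ℝ (Fin p) → EuclideanSpace ℝ (Fin q)} {Bf Mf Lf Mg Lg : ℝ}

theorem norm_fderiv_g_le (hr : Regular Pw f g Bf Mf Lf Mg Lg) (hMg : 0 ≤ Mg) (w : W)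
    (x : EuclideanSpace ℝ (Fin p)) : ‖fderiv ℝ (g w) x‖ ≤ Mg :=
  norm_fderiv_le_of_norm_sub_le hMg (hr.lipschitz_g w) x

theorem norm_fderiv_f_le (hr : Regular Pw f g Bf Mf Lf Mg Lg) (v : V)
    (y : EuclideanSpace ℝ (Fin q)) : ‖fderiv ℝ (f v) y‖ ≤ Mf :=
  norm_gradient (f v) y ▸ hr.bounded_grad_f v y

theorem measurable_gradient_param (hr : Regular Pw f g Bf Mf Lf Mg Lg)
    (y : EuclideanSpace ℝ (Fin q)) : Measurable fun v => gradient (f v) y :=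
  (InnerProductSpace.toDual ℝ (EuclideanSpace ℝ (Fin q))).symm.continuous.measurable.comp
    (measurable_fderiv_param hr.measurable_f hr.differentiable_f y)

theorem continuous_gradient (hr : Regular Pw f g Bf Mf Lf Mg Lg) (v : V) :
    Continuous fun y => gradient (f v) y :=
  (LipschitzWith.of_dist_le' (K := Lf) fun y₁ y₂ => by
    simpa [dist_eq_norm] using hr.smooth_f v y₁ y₂).continuous

theorem continuous_fderiv (hr : Regular Pw f g Bf Mf Lf Mg Lg) (w : W) :
    Continuous fun x => fderiv ℝ (g w) x :=
  (LipschitzWith.of_dist_le' (K := Lg) fun y₁ y₂ => by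
    simpa [dist_eq_norm] using hr.smooth_g w y₁ y₂).continuous

theorem measurable_uncurry_g (hr : Regular Pw f g Bf Mf Lf Mg Lg) :
    Measurable fun r : EuclideanSpace ℝ (Fin p) × W => g r.2 r.1 :=
  measurable_uncurry_of_continuous_of_measurable (u := fun x w => g w x)
    (fun w => (hr.differentiable_g w).continuous) hr.measurable_g

theorem measurable_uncurry_fderiv_g (hr : Regular Pw f g Bf Mf Lf Mg Lg) :
    Measurable fun r : EuclideanSpace ℝ (Fin p) × W => fderiv ℝ (g r.2) r.1 :=
  measurable_uncurry_of_continuous_of_measurable (u := fun x w => fderiv ℝ (g w) x)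
    hr.continuous_fderiv
    fun x => measurable_fderiv_param hr.measurable_g hr.differentiable_g x

theorem measurable_uncurry_gradient_f (hr : Regular Pw f g Bf Mf Lf Mg Lg) :
    Measurable fun r : EuclideanSpace ℝ (Fin q) × V => gradient (f r.2) r.1 :=
  measurable_uncurry_of_continuous_of_measurable (u := fun x v => gradient (f v) x)
    hr.continuous_gradient hr.measurable_gradient_param

theorem integrable_f [IsProbabilityMeasure Pv] (hr : Regular Pw f g Bf Mf Lf Mg Lg)
    (y : EuclideanSpace ℝ (Fin q)) : Integrable (fun v => f v y) Pv :=
  Integrable.of_bound (hr.measurable_f y).aestronglyMeasurable Bf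
    (Eventually.of_forall fun v => hr.bounded_f v y)

/-- The Riesz isometry commutes with the Bochner integral, so the results on derivatives of
parametric integrals carry over to gradients. -/
theorem toDual_meanGrad (y : EuclideanSpace ℝ (Fin q)) :
    InnerProductSpace.toDual ℝ _ (meanGrad Pv f y) = ∫ v, fderiv ℝ (f v) y ∂Pv := by
  simp_rw [← toDual_gradient]
  exact ((InnerProductSpace.toDual ℝ
    (EuclideanSpace ℝ (Fin q))).toContinuousLinearEquiv.integral_comp_comm _).symm

theorem hasGradientAt_outer [IsProbabilityMeasure Pv] (hr : Regular Pw f g Bf Mf Lf Mg Lg)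
    (y : EuclideanSpace ℝ (Fin q)) :
    HasGradientAt (fun y => ∫ v, f v y ∂Pv) (meanGrad Pv f y) y := by
  rw [hasGradientAt_iff_hasFDerivAt, toDual_meanGrad]
  exact hasFDerivAt_integral_param hr.measurable_f hr.integrable_f hr.differentiable_f
    hr.norm_fderiv_f_le y

theorem norm_meanGrad_le [IsProbabilityMeasure Pv] (hr : Regular Pw f g Bf Mf Lf Mg Lg)
    (y : EuclideanSpace ℝ (Fin q)) : ‖meanGrad Pv f y‖ ≤ Mf := by
  rw [← (InnerProductSpace.toDual ℝ _).norm_map, toDual_meanGrad]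
  exact norm_integral_fderiv_le hr.norm_fderiv_f_le y

theorem norm_meanGrad_sub_le [IsProbabilityMeasure Pv] (hr : Regular Pw f g Bf Mf Lf Mg Lg)
    (y₁ y₂ : EuclideanSpace ℝ (Fin q)) :
    ‖meanGrad Pv f y₁ - meanGrad Pv f y₂‖ ≤ Lf * ‖y₁ - y₂‖ := by
  rw [← (InnerProductSpace.toDual ℝ _).norm_map, map_sub, toDual_meanGrad, toDual_meanGrad]
  exact norm_integral_fderiv_sub_le hr.measurable_f hr.differentiable_f hr.norm_fderiv_f_le
    (fun v y₁ y₂ => norm_gradient_sub (f v) y₁ y₂ ▸ hr.smooth_f v y₁ y₂) y₁ y₂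

theorem abs_objective_le [IsProbabilityMeasure Pv] (hr : Regular Pw f g Bf Mf Lf Mg Lg)
    (x : EuclideanSpace ℝ (Fin p)) : |objective Pv Pw f g x| ≤ Bf := by
  have := norm_integral_le_of_norm_le_const (μ := Pv) (f := fun v => f v (innerMap Pw g x))
    (Eventually.of_forall fun v => hr.bounded_f v (innerMap Pw g x))
  simpa [objective] using this

variable [IsProbabilityMeasure Pw]

theorem hasFDerivAt_innerMap (hr : Regular Pw f g Bf Mf Lf Mg Lg) (hMg : 0 ≤ Mg)
    (x : EuclideanSpace ℝ (Fin p)) : HasFDerivAt (innerMap Pw g) (meanJac Pw g x) x :=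
  hasFDerivAt_integral_param hr.measurable_g hr.integrable_g hr.differentiable_g
    (hr.norm_fderiv_g_le hMg) x

theorem norm_meanJac_le (hr : Regular Pw f g Bf Mf Lf Mg Lg) (hMg : 0 ≤ Mg)
    (x : EuclideanSpace ℝ (Fin p)) : ‖meanJac Pw g x‖ ≤ Mg :=
  norm_integral_fderiv_le (hr.norm_fderiv_g_le hMg) x

theorem norm_meanJac_sub_le (hr : Regular Pw f g Bf Mf Lf Mg Lg) (hMg : 0 ≤ Mg)
    (x₁ x₂ : EuclideanSpace ℝ (Fin p)) :
    ‖meanJac Pw g x₁ - meanJac Pw g x₂‖ ≤ Lg * ‖x₁ - x₂‖ :=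
  norm_integral_fderiv_sub_le hr.measurable_g hr.differentiable_g (hr.norm_fderiv_g_le hMg)
    hr.smooth_g x₁ x₂

theorem norm_innerMap_sub_le (hr : Regular Pw f g Bf Mf Lf Mg Lg)
    (x₁ x₂ : EuclideanSpace ℝ (Fin p)) :
    ‖innerMap Pw g x₁ - innerMap Pw g x₂‖ ≤ Mg * ‖x₁ - x₂‖ := by
  rw [innerMap, innerMap, ← integral_sub (hr.integrable_g x₁) (hr.integrable_g x₂)]
  simpa using norm_integral_le_of_norm_le_const (μ := Pw)
    (Eventually.of_forall fun w => hr.lipschitz_g w x₁ x₂)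

theorem innerMap_remainder (hr : Regular Pw f g Bf Mf Lf Mg Lg) (hMg : 0 ≤ Mg) (hLg : 0 ≤ Lg)
    (x y : EuclideanSpace ℝ (Fin p)) :
    ‖innerMap Pw g y - innerMap Pw g x - meanJac Pw g x (y - x)‖ ≤ Lg * ‖y - x‖ ^ 2 := by
  have hd x : fderiv ℝ (innerMap Pw g) x = meanJac Pw g x := (hr.hasFDerivAt_innerMap hMg x).fderiv
  rw [← hd]
  exact norm_sub_sub_fderiv_le hLg (fun x => (hr.hasFDerivAt_innerMap hMg x).differentiableAt)
    (fun x y => by rw [hd, hd]; exact hr.norm_meanJac_sub_le hMg x y) x y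

variable [IsProbabilityMeasure Pv]

theorem hasGradientAt_objective (hr : Regular Pw f g Bf Mf Lf Mg Lg) (hMg : 0 ≤ Mg)
    (x : EuclideanSpace ℝ (Fin p)) :
    HasGradientAt (objective Pv Pw f g)
      (ContinuousLinearMap.adjoint (meanJac Pw g x) (meanGrad Pv f (innerMap Pw g x))) x := by
  rw [hasGradientAt_iff_hasFDerivAt]
  have := (hasGradientAt_iff_hasFDerivAt.1 (hr.hasGradientAt_outer (Pv := Pv)
    (innerMap Pw g x))).comp x (hr.hasFDerivAt_innerMap hMg x)
  have he : InnerProductSpace.toDual ℝ _ (ContinuousLinearMap.adjoint (meanJac Pw g x)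
      (meanGrad Pv f (innerMap Pw g x))) =
      (InnerProductSpace.toDual ℝ _ (meanGrad Pv f (innerMap Pw g x))).comp (meanJac Pw g x) := by
    ext e
    simp [ContinuousLinearMap.adjoint_inner_left]
  rw [he]
  exact this

theorem differentiable_objective (hr : Regular Pw f g Bf Mf Lf Mg Lg) (hMg : 0 ≤ Mg) :
    Differentiable ℝ (objective Pv Pw f g) :=
  fun x => (hr.hasGradientAt_objective hMg x).differentiableAt

theorem gradient_objective (hr : Regular Pw f g Bf Mf Lf Mg Lg) (hMg : 0 ≤ Mg)
    (x : EuclideanSpace ℝ (Fin p)) : gradient (objective Pv Pw f g) x =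
      ContinuousLinearMap.adjoint (meanJac Pw g x) (meanGrad Pv f (innerMap Pw g x)) :=
  (hr.hasGradientAt_objective hMg x).gradient

theorem norm_gradient_objective_le (hr : Regular Pw f g Bf Mf Lf Mg Lg) (hMg : 0 ≤ Mg)
    (x : EuclideanSpace ℝ (Fin p)) : ‖gradient (objective Pv Pw f g) x‖ ≤ Mg * Mf := by
  rw [hr.gradient_objective hMg]
  refine (ContinuousLinearMap.le_opNorm _ _).trans ?_
  rw [LinearIsometryEquiv.norm_map]
  exact mul_le_mul (hr.norm_meanJac_le hMg x) (hr.norm_meanGrad_le _) (norm_nonneg _) hMg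

theorem norm_gradient_objective_sub_le (hr : Regular Pw f g Bf Mf Lf Mg Lg) (hMg : 0 ≤ Mg)
    (hLf : 0 ≤ Lf) (hLg : 0 ≤ Lg) (x y : EuclideanSpace ℝ (Fin p)) :
    ‖gradient (objective Pv Pw f g) x - gradient (objective Pv Pw f g) y‖
      ≤ (Lg * Mf + Mg * (Lf * Mg)) * ‖x - y‖ := by
  rw [hr.gradient_objective hMg, hr.gradient_objective hMg]
  refine (norm_adjoint_apply_sub_le _ _ _ _).trans ?_
  have h1 := hr.norm_meanJac_sub_le hMg x y
  have h2 := hr.norm_meanGrad_le (Pv := Pv) (innerMap Pw g x)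
  have h3 := hr.norm_meanJac_le hMg y
  have h4 := (hr.norm_meanGrad_sub_le (Pv := Pv) (innerMap Pw g x) (innerMap Pw g y)).trans
    (mul_le_mul_of_nonneg_left (hr.norm_innerMap_sub_le x y) hLf)
  calc _ ≤ Lg * ‖x - y‖ * Mf + Mg * (Lf * (Mg * ‖x - y‖)) := by gcongr
    _ = _ := by ring

theorem objective_remainder (hr : Regular Pw f g Bf Mf Lf Mg Lg) (hMf : 0 ≤ Mf) (hMg : 0 ≤ Mg)
    (hLf : 0 ≤ Lf) (hLg : 0 ≤ Lg) (x y : EuclideanSpace ℝ (Fin p)) :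
    objective Pv Pw f g y ≤ objective Pv Pw f g x
      + inner ℝ (gradient (objective Pv Pw f g) x) (y - x)
      + (Lg * Mf + Mg * (Lf * Mg)) * ‖y - x‖ ^ 2 := by
  have := norm_sub_sub_fderiv_le (f := objective Pv Pw f g)
    (L := Lg * Mf + Mg * (Lf * Mg)) (by positivity)
    (hr.differentiable_objective hMg)
    (fun x y => by
      rw [← norm_gradient_sub]
      exact hr.norm_gradient_objective_sub_le hMg hLf hLg x y) x y
  rw [Real.norm_eq_abs, ← inner_gradient] at this
  linarith [le_abs_self (objective Pv Pw f g y - objective Pv Pw f g x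
    - inner ℝ (gradient (objective Pv Pw f g) x) (y - x))]

theorem continuous_gradient_objective (hr : Regular Pw f g Bf Mf Lf Mg Lg) (hMg : 0 ≤ Mg)
    (hLf : 0 ≤ Lf) (hLg : 0 ≤ Lg) : Continuous (gradient (objective Pv Pw f g)) :=
  (LipschitzWith.of_dist_le' (K := Lg * Mf + Mg * (Lf * Mg)) fun x y => by
    simpa [dist_eq_norm] using hr.norm_gradient_objective_sub_le hMg hLf hLg x y).continuous

end Regular

/-! ### Second moments of mini-batch means. -/

section SecondMoment

variable {Ω E : Type*} [MeasurableSpace Ω] {P : Measure Ω} [NormedAddCommGroup E]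

theorem integrable_norm_sq_of_lintegral_le {Z : Ω → E} {c : ℝ} (hZ : AEStronglyMeasurable Z P)
    (h : ∫⁻ ω, ‖Z ω‖ₑ ^ 2 ∂P ≤ ENNReal.ofReal c) : Integrable (fun ω => ‖Z ω‖ ^ 2) P := by
  refine ⟨hZ.norm.pow 2, ?_⟩
  rw [hasFiniteIntegral_iff_enorm]
  simp only [enorm_pow, enorm_norm]
  exact h.trans_lt ENNReal.ofReal_lt_top

theorem ofReal_integral_norm_sq {Z : Ω → E} (h : Integrable (fun ω => ‖Z ω‖ ^ 2) P) :
    ENNReal.ofReal (∫ ω, ‖Z ω‖ ^ 2 ∂P) = ∫⁻ ω, ‖Z ω‖ₑ ^ 2 ∂P := by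
  rw [ofReal_integral_eq_lintegral_ofReal h (Eventually.of_forall fun ω => by positivity)]
  refine lintegral_congr fun ω => ?_
  rw [ENNReal.ofReal_pow (norm_nonneg _), ofReal_norm]

theorem integral_norm_sq_le_of_lintegral_le {Z : Ω → E} {c : ℝ} (hc : 0 ≤ c)
    (hZ : AEStronglyMeasurable Z P)
    (h : ∫⁻ ω, ‖Z ω‖ₑ ^ 2 ∂P ≤ ENNReal.ofReal c) : ∫ ω, ‖Z ω‖ ^ 2 ∂P ≤ c := by
  rw [← ofReal_integral_norm_sq (integrable_norm_sq_of_lintegral_le hZ h)] at h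
  exact (ENNReal.ofReal_le_ofReal_iff hc).1 h

end SecondMoment

theorem measurable_batchMean_of_forall {X E : Type*} [MeasurableSpace X] [NormedAddCommGroup E]
    [NormedSpace ℝ E] [FiniteDimensional ℝ E] [MeasurableSpace E] [BorelSpace E]
    {F : X → ℕ → E} (K : ℕ) (hF : ∀ j, Measurable fun r => F r j) :
    Measurable fun r => batchMean K (F r) := by
  have : SecondCountableTopology E := by
    have := FiniteDimensional.proper ℝ E
    infer_instance
  unfold batchMean
  exact (Finset.measurable_fun_sum _ fun j _ => hF j).const_smul (K : ℝ)⁻¹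

section Batch

variable {Ω E : Type*} [MeasurableSpace Ω] {P : Measure Ω} [IsProbabilityMeasure P]
  [NormedAddCommGroup E] [InnerProductSpace ℝ E] [FiniteDimensional ℝ E] [MeasurableSpace E]
  [BorelSpace E]

/-- The mean of `K` pairwise independent unbiased estimates with variance at most `σ²` has
variance at most `σ² / K`. -/
theorem lintegral_batchMean_sub_le {Y : ℕ → Ω → E} {H : E} {σ : ℝ} {K : ℕ} (hK : 0 < K)
    (hm : ∀ j, Measurable (Y j)) (hindep : Pairwise fun i j => IndepFun (Y i) (Y j) P)
    (hmean : ∀ j, ∫ ω, Y j ω ∂P = H)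
    (hvar : ∀ j, ∫⁻ ω, ‖Y j ω - H‖ₑ ^ 2 ∂P ≤ ENNReal.ofReal (σ ^ 2)) :
    ∫⁻ ω, ‖batchMean K (fun j => Y j ω) - H‖ₑ ^ 2 ∂P ≤ ENNReal.ofReal (σ ^ 2 / K) := by
  have : SecondCountableTopology E := by
    have := FiniteDimensional.proper ℝ E
    infer_instance
  have : CompleteSpace E := FiniteDimensional.complete ℝ E
  set Z : ℕ → Ω → E := fun j ω => Y j ω - H with hZ
  have hZm j : Measurable (Z j) := (hm j).sub_const H
  have hZi j : Integrable (fun ω => ‖Z j ω‖ ^ 2) P :=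
    integrable_norm_sq_of_lintegral_le (hZm j).aestronglyMeasurable (hvar j)
  have hZL j : MemLp (Z j) 2 P :=
    (memLp_two_iff_integrable_sq_norm (hZm j).aestronglyMeasurable).2 (hZi j)
  have hZ1 j : Integrable (Z j) P := (hZL j).integrable (by norm_num)
  have hY1 j : Integrable (Y j) P := by
    have := (hZ1 j).add (integrable_const H)
    refine this.congr (Eventually.of_forall fun ω => ?_)
    simp [hZ]
  have hZ0 j : ∫ ω, Z j ω ∂P = 0 := by
    rw [hZ, integral_sub (hY1 j) (integrable_const H), hmean j]
    simp
  have hcross i j : Integrable (fun ω => inner ℝ (Z i ω) (Z j ω)) P := by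
    refine ((hZi i).add (hZi j)).mono'
      ((hZm i).aestronglyMeasurable.inner (hZm j).aestronglyMeasurable)
      (Eventually.of_forall fun ω => (norm_inner_le_norm _ _).trans ?_)
    simp only [Pi.add_apply]
    nlinarith [sq_nonneg (‖Z i ω‖ - ‖Z j ω‖), sq_nonneg ‖Z i ω‖, sq_nonneg ‖Z j ω‖]
  have hcross0 i j (hij : i ≠ j) : ∫ ω, inner ℝ (Z i ω) (Z j ω) ∂P = 0 := by
    have hi : IndepFun (Z i) (Z j) P :=
      (hindep hij).comp (measurable_id.sub_const H) (measurable_id.sub_const H)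
    have := hi.integral_bilin (hZ1 i) (hZ1 j) (innerSL ℝ)
    exact this.trans (by simp [hZ0])
  have heq ω : batchMean K (fun j => Y j ω) - H = (K : ℝ)⁻¹ • ∑ j ∈ Finset.range K, Z j ω := by
    simp only [batchMean, hZ, Finset.sum_sub_distrib, Finset.sum_const, Finset.card_range,
      smul_sub]
    rw [← Nat.cast_smul_eq_nsmul ℝ, smul_smul, inv_mul_cancel₀ (by positivity), one_smul]
  have hsq ω : ‖batchMean K (fun j => Y j ω) - H‖ ^ 2 =
      ((K : ℝ)⁻¹) ^ 2 * ∑ i ∈ Finset.range K, ∑ j ∈ Finset.range K,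
        inner ℝ (Z i ω) (Z j ω) := by
    rw [heq, norm_smul, mul_pow, ← real_inner_self_eq_norm_sq (∑ j ∈ Finset.range K, Z j ω),
      sum_inner]
    simp [inner_sum]
  have hint : Integrable (fun ω => ‖batchMean K (fun j => Y j ω) - H‖ ^ 2) P := by
    simp only [hsq]
    exact (integrable_finsetSum _ fun i _ => integrable_finsetSum _ fun j _ =>
      hcross i j).const_mul _
  rw [← ofReal_integral_norm_sq hint]
  refine ENNReal.ofReal_le_ofReal ?_
  simp only [hsq]
  rw [integral_const_mul, integral_finsetSum _ fun i _ => integrable_finsetSum _ fun j _ =>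
      hcross i j]
  have hdiag i (hi : i ∈ Finset.range K) :
      ∫ ω, ∑ j ∈ Finset.range K, inner ℝ (Z i ω) (Z j ω) ∂P ≤ σ ^ 2 := by
    rw [integral_finsetSum _ fun j _ => hcross i j,
      Finset.sum_eq_single_of_mem i hi fun j _ hj => hcross0 i j hj.symm]
    simp only [real_inner_self_eq_norm_sq]
    exact integral_norm_sq_le_of_lintegral_le (sq_nonneg σ) (hZm i).aestronglyMeasurable (hvar i)
  calc _ ≤ ((K : ℝ)⁻¹) ^ 2 * ∑ i ∈ Finset.range K, σ ^ 2 := by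
        gcongr with i hi
        exact hdiag i hi
    _ = σ ^ 2 / K := by
        simp
        field_simp

theorem measurable_batchMean {X W : Type*} [MeasurableSpace X] [MeasurableSpace W]
    {h : X → W → E} (hh : Measurable fun r : X × W => h r.1 r.2) (K : ℕ) :
    Measurable fun r : X × (ℕ → W) => batchMean K fun j => h r.1 (r.2 j) :=
  measurable_batchMean_of_forall K fun j =>
    hh.comp (measurable_fst.prodMk ((measurable_pi_apply j).comp measurable_snd))

/-- The variance bound of a batch mean at a random query point that is independent of the
batch. -/
theorem lintegral_batchMean_random_le {X W : Type*} [MeasurableSpace X] [MeasurableSpace W]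
    {ξ : ℕ → Ω → W} {Z : Ω → X} {h : X → W → E} {H : X → E} {σ : ℝ} {K : ℕ} (hK : 0 < K)
    (hξ : ∀ j, Measurable (ξ j)) (hZ : Measurable Z)
    (hindep : Pairwise fun i j => IndepFun (ξ i) (ξ j) P)
    (hZξ : IndepFun Z (fun ω j => ξ j ω) P)
    (hh : Measurable fun r : X × W => h r.1 r.2) (hH : Measurable H)
    (hmean : ∀ x j, ∫ ω, h x (ξ j ω) ∂P = H x)
    (hvar : ∀ x j, ∫⁻ ω, ‖h x (ξ j ω) - H x‖ₑ ^ 2 ∂P ≤ ENNReal.ofReal (σ ^ 2)) :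
    ∫⁻ ω, ‖batchMean K (fun j => h (Z ω) (ξ j ω)) - H (Z ω)‖ₑ ^ 2 ∂P
      ≤ ENNReal.ofReal (σ ^ 2 / K) := by
  have : SecondCountableTopology E := by
    have := FiniteDimensional.proper ℝ E
    infer_instance
  have hξ' : Measurable fun ω j => ξ j ω := measurable_pi_lambda _ hξ
  set Φ : X × (ℕ → W) → ENNReal := fun r =>
    ‖batchMean K (fun j => h r.1 (r.2 j)) - H r.1‖ₑ ^ 2 with hΦ
  have hΦm : Measurable Φ :=
    ((measurable_batchMean hh K).sub (hH.comp measurable_fst)).enorm.pow_const 2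
  -- By independence the joint law of query point and batch is a product. Tonelli then freezes the
  -- query point and reduces the claim to the deterministic case.
  have h1 : ∫⁻ ω, Φ (Z ω, fun j => ξ j ω) ∂P
      = ∫⁻ r, Φ r ∂((P.map Z).prod (P.map fun ω j => ξ j ω)) := by
    rw [← (indepFun_iff_map_prod_eq_prod_map_map hZ.aemeasurable hξ'.aemeasurable).1 hZξ,
      lintegral_map hΦm (hZ.prodMk hξ')]
  have : IsProbabilityMeasure (P.map Z) := Measure.isProbabilityMeasure_map hZ.aemeasurable
  have : IsProbabilityMeasure (P.map fun ω j => ξ j ω) :=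
    Measure.isProbabilityMeasure_map hξ'.aemeasurable
  change ∫⁻ ω, Φ (Z ω, fun j => ξ j ω) ∂P ≤ _
  rw [h1, lintegral_prod _ hΦm.aemeasurable]
  calc _ ≤ ∫⁻ _, ENNReal.ofReal (σ ^ 2 / K) ∂(P.map Z) := by
        refine lintegral_mono fun x => ?_
        rw [lintegral_map (f := fun y => Φ (x, y)) (hΦm.comp measurable_prodMk_left) hξ']
        have hx : Measurable (h x) := hh.comp measurable_prodMk_left
        exact lintegral_batchMean_sub_le hK (fun j => hx.comp (hξ j))
          (fun i j hij => (hindep hij).comp hx hx) (hmean x) (hvar x)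
    _ = _ := by simp

end Batch

/-! ### Components of one iteration and their measurability. -/

section Run

variable {p q : ℕ} {Ω V W : Type u} (A : Params) (f : V → EuclideanSpace ℝ (Fin q) → ℝ)
  (g : W → EuclideanSpace ℝ (Fin p) → EuclideanSpace ℝ (Fin q)) (S : Samples Ω V W)

/-- The mini-batch mean of the Jacobians in iteration `t` at the point `x`. -/
noncomputable def jacMean (t : ℕ) (x : EuclideanSpace ℝ (Fin p)) (ω : Ω) :
    EuclideanSpace ℝ (Fin p) →L[ℝ] EuclideanSpace ℝ (Fin q) :=
  batchMean (A.K₁ t) fun j => fderiv ℝ (g (S.jac t j ω)) x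

/-- The mini-batch mean of the gradients in iteration `t` at the point `y`. -/
noncomputable def gradMean (t : ℕ) (y : EuclideanSpace ℝ (Fin q)) (ω : Ω) :
    EuclideanSpace ℝ (Fin q) :=
  batchMean (A.K₂ t) fun j => gradient (f (S.grad t j ω)) y

/-- The mini-batch mean of the values of the inner maps in iteration `t` at the point `z`. -/
noncomputable def valMean (t : ℕ) (z : EuclideanSpace ℝ (Fin p)) (ω : Ω) :
    EuclideanSpace ℝ (Fin q) :=
  batchMean (A.K₃ t) fun j => g (S.val t j ω) z

/-- The stochastic direction `d_t` of iteration `t` in the state `s`. -/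
noncomputable def direction (t : ℕ) (s : State p q) (ω : Ω) : EuclideanSpace ℝ (Fin p) :=
  ContinuousLinearMap.adjoint (jacMean A g S t s.x ω) (gradMean A f S t s.y ω)

variable (ω : Ω) (t : ℕ) (s : State p q)

theorem step_m : (step A f g S ω t s).m
    = A.γ₁ t • s.m + (1 - A.γ₁ t) • direction A f g S t s ω := rfl

theorem step_v : (step A f g S ω t s).v
    = WithLp.toLp 2 fun i => A.γ₂ t * s.v i + (1 - A.γ₂ t) * direction A f g S t s ω i ^ 2 := rfl

theorem step_x : (step A f g S ω t s).x
    = WithLp.toLp 2 fun i => s.x i - A.α t * ((step A f g S ω t s).m i /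
      (Real.sqrt ((step A f g S ω t s).v i) + A.ε)) := rfl

theorem step_z : (step A f g S ω t s).z
    = (1 - 1 / A.β t) • s.x + (1 / A.β t) • (step A f g S ω t s).x := rfl

theorem step_y : (step A f g S ω t s).y
    = (1 - A.β t) • s.y + A.β t • valMean A g S t (step A f g S ω t s).z ω := rfl

end Run

section Measurability

variable {p q : ℕ} {Ω V W : Type u} [mΩ : MeasurableSpace Ω] [MeasurableSpace V]
  [MeasurableSpace W] {Pw : Measure W} {A : Params} {f : V → EuclideanSpace ℝ (Fin q) → ℝ}
  {g : W → EuclideanSpace ℝ (Fin p) → EuclideanSpace ℝ (Fin q)} {Bf Mf Lf Mg Lg : ℝ}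
  {S : Samples Ω V W}

/-- Measurability of those components of a random state that later iterations use. -/
structure MeasurableState (s : Ω → State p q) : Prop where
  x : Measurable fun ω => (s ω).x
  y : Measurable fun ω => (s ω).y
  m : Measurable fun ω => (s ω).m
  v : Measurable fun ω => (s ω).v

theorem measurable_jacMean (hr : Regular Pw f g Bf Mf Lf Mg Lg) {t : ℕ}
    (hS : ∀ j, Measurable (S.jac t j)) {x : Ω → EuclideanSpace ℝ (Fin p)} (hx : Measurable x) :
    Measurable fun ω => jacMean A g S t (x ω) ω := by
  refine measurable_batchMean_of_forall _ fun j => ?_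
  exact hr.measurable_uncurry_fderiv_g.comp (hx.prodMk (hS j))

theorem measurable_gradMean (hr : Regular Pw f g Bf Mf Lf Mg Lg) {t : ℕ}
    (hS : ∀ j, Measurable (S.grad t j)) {y : Ω → EuclideanSpace ℝ (Fin q)} (hy : Measurable y) :
    Measurable fun ω => gradMean A f S t (y ω) ω := by
  refine measurable_batchMean_of_forall _ fun j => ?_
  exact hr.measurable_uncurry_gradient_f.comp (hy.prodMk (hS j))

theorem measurable_valMean (hr : Regular Pw f g Bf Mf Lf Mg Lg) {t : ℕ}
    (hS : ∀ j, Measurable (S.val t j)) {z : Ω → EuclideanSpace ℝ (Fin p)} (hz : Measurable z) :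
    Measurable fun ω => valMean A g S t (z ω) ω := by
  refine measurable_batchMean_of_forall _ fun j => ?_
  exact hr.measurable_uncurry_g.comp (hz.prodMk (hS j))

theorem measurable_toLp_of_forall {F : Ω → Fin p → ℝ} (h : ∀ i, Measurable fun ω => F ω i) :
    Measurable fun ω => (WithLp.toLp 2 (F ω) : EuclideanSpace ℝ (Fin p)) :=
  (PiLp.continuous_toLp 2 _).measurable.comp (measurable_pi_lambda _ h)

theorem measurable_coord {F : Ω → EuclideanSpace ℝ (Fin p)} (h : Measurable F) (i : Fin p) :
    Measurable fun ω => F ω i :=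
  (EuclideanSpace.proj i : EuclideanSpace ℝ (Fin p) →L[ℝ] ℝ).continuous.measurable.comp h

theorem measurable_direction (hr : Regular Pw f g Bf Mf Lf Mg Lg) {t : ℕ}
    (hj : ∀ j, Measurable (S.jac t j)) (hg : ∀ j, Measurable (S.grad t j))
    {s : Ω → State p q} (hs : MeasurableState s) :
    Measurable fun ω => direction A f g S t (s ω) ω := by
  have heq : (fun ω => direction A f g S t (s ω) ω) = fun ω => WithLp.toLp 2 fun i =>
      inner ℝ (jacMean A g S t (s ω).x ω (EuclideanSpace.single i 1))
        (gradMean A f S t (s ω).y ω) := by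
    ext ω i
    change direction A f g S t (s ω) ω i
      = inner ℝ (jacMean A g S t (s ω).x ω (EuclideanSpace.single i 1))
        (gradMean A f S t (s ω).y ω)
    rw [← ContinuousLinearMap.adjoint_inner_right, EuclideanSpace.inner_single_left]
    simp [direction]
  rw [heq]
  refine measurable_toLp_of_forall fun i => Measurable.inner ?_ (measurable_gradMean hr hg hs.y)
  exact (ContinuousLinearMap.apply ℝ (EuclideanSpace ℝ (Fin q))
    (EuclideanSpace.single i (1 : ℝ))).continuous.measurable.comp (measurable_jacMean hr hj hs.x)

theorem measurable_step_m (hr : Regular Pw f g Bf Mf Lf Mg Lg) {t : ℕ}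
    (hj : ∀ j, Measurable (S.jac t j)) (hg : ∀ j, Measurable (S.grad t j))
    {s : Ω → State p q} (hs : MeasurableState s) :
    Measurable fun ω => (step A f g S ω t (s ω)).m := by
  simp only [step_m]
  exact (hs.m.const_smul (A.γ₁ t)).add ((measurable_direction hr hj hg hs).const_smul (1 - A.γ₁ t))

theorem measurable_step_v (hr : Regular Pw f g Bf Mf Lf Mg Lg) {t : ℕ}
    (hj : ∀ j, Measurable (S.jac t j)) (hg : ∀ j, Measurable (S.grad t j))
    {s : Ω → State p q} (hs : MeasurableState s) :
    Measurable fun ω => (step A f g S ω t (s ω)).v := by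
  simp only [step_v]
  exact measurable_toLp_of_forall fun i => ((measurable_coord hs.v i).const_mul _).add
    (((measurable_coord (measurable_direction hr hj hg hs) i).pow_const 2).const_mul _)

theorem measurable_step_x (hr : Regular Pw f g Bf Mf Lf Mg Lg) {t : ℕ}
    (hj : ∀ j, Measurable (S.jac t j)) (hg : ∀ j, Measurable (S.grad t j))
    {s : Ω → State p q} (hs : MeasurableState s) :
    Measurable fun ω => (step A f g S ω t (s ω)).x := by
  simp only [step_x]
  exact measurable_toLp_of_forall fun i => (measurable_coord hs.x i).sub
    (((measurable_coord (measurable_step_m hr hj hg hs) i).div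
      ((measurable_coord (measurable_step_v hr hj hg hs) i).sqrt.add_const _)).const_mul _)

theorem measurable_step_z (hr : Regular Pw f g Bf Mf Lf Mg Lg) {t : ℕ}
    (hj : ∀ j, Measurable (S.jac t j)) (hg : ∀ j, Measurable (S.grad t j))
    {s : Ω → State p q} (hs : MeasurableState s) :
    Measurable fun ω => (step A f g S ω t (s ω)).z := by
  simp only [step_z]
  exact (hs.x.const_smul (1 - 1 / A.β t)).add
    ((measurable_step_x hr hj hg hs).const_smul (1 / A.β t))

theorem measurableState_run (hr : Regular Pw f g Bf Mf Lf Mg Lg)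
    (x₁ : EuclideanSpace ℝ (Fin p)) (n : ℕ)
    (hj : ∀ t ≤ n, ∀ j, Measurable (S.jac t j)) (hg : ∀ t ≤ n, ∀ j, Measurable (S.grad t j))
    (hv : ∀ t ≤ n, ∀ j, Measurable (S.val t j)) :
    MeasurableState fun ω => run A f g S x₁ ω n := by
  induction n with
  | zero => constructor <;> exact measurable_const
  | succ n ih =>
    have hs := ih (fun t ht => hj t (by omega)) (fun t ht => hg t (by omega))
      (fun t ht => hv t (by omega))
    have hj := hj (n + 1) le_rfl
    have hg := hg (n + 1) le_rfl
    refine ⟨measurable_step_x hr hj hg hs, ?_, measurable_step_m hr hj hg hs,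
      measurable_step_v hr hj hg hs⟩
    simp only [run, step_y]
    exact (hs.y.const_smul (1 - A.β (n + 1))).add ((measurable_valMean hr (hv (n + 1) le_rfl)
      (measurable_step_z hr hj hg hs)).const_smul (A.β (n + 1)))

end Measurability

/-! ### Independence of the query points from the batches, and conditional variance bounds. -/

namespace UnbiasedBoundedVariance

variable {Ω V W : Type u} [MeasurableSpace V] [MeasurableSpace W] {S : Samples Ω V W}

theorem measurable_jac_iSup {s : Set Call} {t j : ℕ} (hs : Call.jac t j ∈ s) :
    Measurable[⨆ i ∈ s, S.sigma i] (S.jac t j) :=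
  (comap_measurable (S.jac t j)).mono
    (le_iSup₂_of_le (f := fun i (_ : i ∈ s) => S.sigma i) (Call.jac t j) hs le_rfl) le_rfl

theorem measurable_grad_iSup {s : Set Call} {t j : ℕ} (hs : Call.grad t j ∈ s) :
    Measurable[⨆ i ∈ s, S.sigma i] (S.grad t j) :=
  (comap_measurable (S.grad t j)).mono
    (le_iSup₂_of_le (f := fun i (_ : i ∈ s) => S.sigma i) (Call.grad t j) hs le_rfl) le_rfl

theorem measurable_val_iSup {s : Set Call} {t j : ℕ} (hs : Call.val t j ∈ s) :
    Measurable[⨆ i ∈ s, S.sigma i] (S.val t j) :=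
  (comap_measurable (S.val t j)).mono
    (le_iSup₂_of_le (f := fun i (_ : i ∈ s) => S.sigma i) (Call.val t j) hs le_rfl) le_rfl

/-- The preceding measurability lemmas hold for any σ-algebra on `Ω`. With the one generated by a
set of calls they express that the state depends on these calls only, which is the source of its
independence from a later batch. -/
theorem measurableState_run_iSup {p q : ℕ} {Pw : Measure W} {A : Params}
    {f : V → EuclideanSpace ℝ (Fin q) → ℝ}
    {g : W → EuclideanSpace ℝ (Fin p) → EuclideanSpace ℝ (Fin q)} {Bf Mf Lf Mg Lg : ℝ}
    (hr : Regular Pw f g Bf Mf Lf Mg Lg)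
    (x₁ : EuclideanSpace ℝ (Fin p)) (n : ℕ) {s : Set Call}
    (hs : ∀ t ≤ n, ∀ j, Call.jac t j ∈ s ∧ Call.grad t j ∈ s ∧ Call.val t j ∈ s) :
    MeasurableState (mΩ := ⨆ i ∈ s, S.sigma i) fun ω => run A f g S x₁ ω n :=
  measurableState_run (mΩ := ⨆ i ∈ s, S.sigma i) hr x₁ n
    (fun t ht j => measurable_jac_iSup (hs t ht j).1)
    (fun t ht j => measurable_grad_iSup (hs t ht j).2.1)
    (fun t ht j => measurable_val_iSup (hs t ht j).2.2)

end UnbiasedBoundedVariance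

section Noise

variable {p q : ℕ} {Ω V W : Type u} [mΩ : MeasurableSpace Ω] [mV : MeasurableSpace V]
  [mW : MeasurableSpace W] {P : Measure Ω} {Pv : Measure V} {Pw : Measure W}
  {A : Params} {f : V → EuclideanSpace ℝ (Fin q) → ℝ}
  {g : W → EuclideanSpace ℝ (Fin p) → EuclideanSpace ℝ (Fin q)} {Bf Mf Lf Mg Lg : ℝ}
  {S : Samples Ω V W} {σ₁ σ₂ σ₃ : ℝ}

namespace UnbiasedBoundedVariance

theorem sigma_le (h : UnbiasedBoundedVariance P Pv Pw f g S σ₁ σ₂ σ₃) (c : Call) :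
    S.sigma c ≤ mΩ := by
  cases c with
  | jac t j => exact (h.measurable_jac t j).comap_le
  | grad t j => exact (h.measurable_grad t j).comap_le
  | val t j => exact (h.measurable_val t j).comap_le

/-- The calls split into the batch and its complement, and disjoint groups of independent σ-algebras
generate independent σ-algebras. -/
theorem indepFun_batch (h : UnbiasedBoundedVariance P Pv Pw f g S σ₁ σ₂ σ₃) {X U : Type*}
    [mX : MeasurableSpace X] [mU : MeasurableSpace U] {ξ : ℕ → Ω → U} {c : ℕ → Call}
    (hξ : ∀ j, Measurable[S.sigma (c j)] (ξ j)) {Z : Ω → X}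
    (hZ : Measurable[⨆ i ∈ (Set.range c)ᶜ, S.sigma i] Z) :
    IndepFun Z (fun ω j => ξ j ω) P := by
  have hi := indep_iSup_of_disjoint h.sigma_le h.indep
    (S := (Set.range c)ᶜ) (T := Set.range c) disjoint_compl_left
  rw [IndepFun_iff_Indep]
  refine indep_of_indep_of_le_left (indep_of_indep_of_le_right hi ?_) hZ.comap_le
  refine Measurable.comap_le (@measurable_pi_lambda _ _ _ (_) _ _ fun j => ?_)
  exact (hξ j).mono (le_iSup₂_of_le (c j) ⟨j, rfl⟩ le_rfl) le_rfl

theorem pairwise_indepFun (h : UnbiasedBoundedVariance P Pv Pw f g S σ₁ σ₂ σ₃) {U : Type*}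
    [mU : MeasurableSpace U] {ξ : ℕ → Ω → U} {c : ℕ → Call} (hc : Function.Injective c)
    (hξ : ∀ j, Measurable[S.sigma (c j)] (ξ j)) :
    Pairwise fun i j => IndepFun (ξ i) (ξ j) P := fun i j hij => by
  change IndepFun (ξ i) (ξ j) P
  rw [IndepFun_iff_Indep]
  exact indep_of_indep_of_le_left (indep_of_indep_of_le_right
    (h.indep.indep (hc.ne hij)) (hξ j).comap_le) (hξ i).comap_le

theorem measurableState (h : UnbiasedBoundedVariance P Pv Pw f g S σ₁ σ₂ σ₃)
    (hr : Regular Pw f g Bf Mf Lf Mg Lg) (x₁ : EuclideanSpace ℝ (Fin p)) (n : ℕ) :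
    MeasurableState fun ω => run A f g S x₁ ω n :=
  measurableState_run hr x₁ n (fun t _ => h.measurable_jac t) (fun t _ => h.measurable_grad t)
    (fun t _ => h.measurable_val t)

theorem measurable_z (h : UnbiasedBoundedVariance P Pv Pw f g S σ₁ σ₂ σ₃)
    (hr : Regular Pw f g Bf Mf Lf Mg Lg) (x₁ : EuclideanSpace ℝ (Fin p)) (n : ℕ) :
    Measurable fun ω => (run A f g S x₁ ω (n + 1)).z :=
  measurable_step_z hr (h.measurable_jac _) (h.measurable_grad _) (h.measurableState hr x₁ n)

end UnbiasedBoundedVariance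

variable [IsProbabilityMeasure P]

theorem lintegral_gradMean_sub_le [IsProbabilityMeasure Pv]
    (h : UnbiasedBoundedVariance P Pv Pw f g S σ₁ σ₂ σ₃)
    (hr : Regular Pw f g Bf Mf Lf Mg Lg) (x₁ : EuclideanSpace ℝ (Fin p)) (n : ℕ)
    (hK : 0 < A.K₂ (n + 1)) :
    ∫⁻ ω, ‖gradMean A f S (n + 1) (run A f g S x₁ ω n).y ω
      - meanGrad Pv f (run A f g S x₁ ω n).y‖ₑ ^ 2 ∂P
      ≤ ENNReal.ofReal (σ₁ ^ 2 / A.K₂ (n + 1)) := by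
  refine lintegral_batchMean_random_le (h := fun y v => gradient (f v) y) hK
    (h.measurable_grad (n + 1)) (h.measurableState hr x₁ n).y
    (h.pairwise_indepFun (c := Call.grad (n + 1)) (fun i j hij => by simpa using hij)
      fun j => comap_measurable _)
    (h.indepFun_batch (c := Call.grad (n + 1)) (fun j => comap_measurable _) ?_)
    hr.measurable_uncurry_gradient_f ?_ (fun y j => h.unbiased_grad _ _ _)
    (fun y j => h.variance_grad _ _ _)
  · refine MeasurableState.y (mΩ := _)
      (UnbiasedBoundedVariance.measurableState_run_iSup hr x₁ n fun t ht j => ?_)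
    simp
    omega
  · exact (LipschitzWith.of_dist_le' (K := Lf) fun y₁ y₂ => by
      simpa [dist_eq_norm] using hr.norm_meanGrad_sub_le (Pv := Pv) y₁ y₂).continuous.measurable

theorem lintegral_valMean_sub_le [IsProbabilityMeasure Pw]
    (h : UnbiasedBoundedVariance P Pv Pw f g S σ₁ σ₂ σ₃)
    (hr : Regular Pw f g Bf Mf Lf Mg Lg) (x₁ : EuclideanSpace ℝ (Fin p)) (n : ℕ)
    (hK : 0 < A.K₃ (n + 1)) :
    ∫⁻ ω, ‖valMean A g S (n + 1) (run A f g S x₁ ω (n + 1)).z ω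
      - innerMap Pw g (run A f g S x₁ ω (n + 1)).z‖ₑ ^ 2 ∂P
      ≤ ENNReal.ofReal (σ₃ ^ 2 / A.K₃ (n + 1)) := by
  refine lintegral_batchMean_random_le (h := fun z w => g w z) hK
    (h.measurable_val (n + 1)) (h.measurable_z hr x₁ n)
    (h.pairwise_indepFun (c := Call.val (n + 1)) (fun i j hij => by simpa using hij)
      fun j => comap_measurable _)
    (h.indepFun_batch (c := Call.val (n + 1)) (fun j => comap_measurable _) ?_)
    hr.measurable_uncurry_g ?_ (fun y j => h.unbiased_val _ _ _)
    (fun y j => h.variance_val _ _ _)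
  -- The query point z depends on the Jacobian and gradient calls of the current iteration, but on
  -- value calls of earlier iterations only.
  · refine measurable_step_z (mΩ := _) hr
      (fun j => UnbiasedBoundedVariance.measurable_jac_iSup (by simp))
      (fun j => UnbiasedBoundedVariance.measurable_grad_iSup (by simp))
      (UnbiasedBoundedVariance.measurableState_run_iSup hr x₁ n fun t ht j => ?_)
    simp
    omega
  · exact (LipschitzWith.of_dist_le' (K := Mg) fun y₁ y₂ => by
      simpa [dist_eq_norm] using hr.norm_innerMap_sub_le y₁ y₂).continuous.measurable

/-- Cauchy–Schwarz: the operator norm is at most the Hilbert–Schmidt norm. The operator norm does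
not come from an inner product, so the variance of a batch mean is computed column by column; the
price is a factor `p`. -/
theorem norm_sq_le_sum_norm_sq_apply (B : EuclideanSpace ℝ (Fin p) →L[ℝ] EuclideanSpace ℝ (Fin q)) :
    ‖B‖ ^ 2 ≤ ∑ i, ‖B (EuclideanSpace.single i 1)‖ ^ 2 := by
  have h : ‖B‖ ≤ Real.sqrt (∑ i, ‖B (EuclideanSpace.single i 1)‖ ^ 2) := by
    refine B.opNorm_le_bound (Real.sqrt_nonneg _) fun x => ?_
    have h1 : B x = ∑ i, x i • B (EuclideanSpace.single i 1) := by
      conv_lhs => rw [clm_eq_sum_smulRight B]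
      simp
    calc ‖B x‖ ≤ ∑ i, |x i| * ‖B (EuclideanSpace.single i 1)‖ := by
          rw [h1]
          refine (norm_sum_le _ _).trans (Finset.sum_le_sum fun i _ => ?_)
          rw [norm_smul, Real.norm_eq_abs]
      _ ≤ Real.sqrt (∑ i, |x i| ^ 2) * Real.sqrt (∑ i, ‖B (EuclideanSpace.single i 1)‖ ^ 2) :=
          Real.sum_mul_le_sqrt_mul_sqrt _ _ _
      _ = _ := by
          rw [EuclideanSpace.norm_eq x, mul_comm]
          simp
  calc ‖B‖ ^ 2 ≤ Real.sqrt (∑ i, ‖B (EuclideanSpace.single i 1)‖ ^ 2) ^ 2 := by gcongr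
    _ = _ := Real.sq_sqrt (by positivity)

theorem lintegral_jacMean_sub_apply_le [IsProbabilityMeasure Pw]
    (h : UnbiasedBoundedVariance P Pv Pw f g S σ₁ σ₂ σ₃)
    (hr : Regular Pw f g Bf Mf Lf Mg Lg) (hMg : 0 ≤ Mg) (x₁ : EuclideanSpace ℝ (Fin p)) (n : ℕ)
    (hK : 0 < A.K₁ (n + 1)) (i : Fin p) :
    ∫⁻ ω, ‖(jacMean A g S (n + 1) (run A f g S x₁ ω n).x ω
      - meanJac Pw g (run A f g S x₁ ω n).x) (EuclideanSpace.single i 1)‖ₑ ^ 2 ∂P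
      ≤ ENNReal.ofReal (σ₂ ^ 2 / A.K₁ (n + 1)) := by
  set e : EuclideanSpace ℝ (Fin p) := EuclideanSpace.single i 1 with he
  have he1 : ‖e‖ = 1 := by simp [he]
  have heval := (ContinuousLinearMap.apply ℝ (EuclideanSpace ℝ (Fin q)) e).continuous.measurable
  have hS : ∀ j, ∀ x, Integrable (fun ω => fderiv ℝ (g (S.jac (n + 1) j ω)) x) P := fun j x =>
    Integrable.of_bound ((measurable_fderiv_param hr.measurable_g hr.differentiable_g x).comp
      (h.measurable_jac (n + 1) j)).aestronglyMeasurable Mg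
      (Eventually.of_forall fun ω => hr.norm_fderiv_g_le hMg _ x)
  have key := lintegral_batchMean_random_le (P := P) (h := fun x w => fderiv ℝ (g w) x e)
    (H := fun x => meanJac Pw g x e) (σ := σ₂) (Z := fun ω => (run A f g S x₁ ω n).x) hK
    (h.measurable_jac (n + 1)) (h.measurableState hr x₁ n).x
    (h.pairwise_indepFun (c := Call.jac (n + 1)) (fun i j hij => by simpa using hij)
      fun j => comap_measurable _)
    (h.indepFun_batch (c := Call.jac (n + 1)) (fun j => comap_measurable _) ?_)
    (heval.comp hr.measurable_uncurry_fderiv_g) ?_ (fun x j => ?_) (fun x j => ?_)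
  · convert key using 4 with ω
    simp [jacMean, batchMean]
  · refine MeasurableState.x (mΩ := _)
      (UnbiasedBoundedVariance.measurableState_run_iSup hr x₁ n fun t ht j => ?_)
    simp
    omega
  · have : Continuous (meanJac Pw g) := (LipschitzWith.of_dist_le' (K := Lg) fun y₁ y₂ => by
      simpa [dist_eq_norm] using hr.norm_meanJac_sub_le hMg y₁ y₂).continuous
    exact heval.comp this.measurable
  · rw [← ContinuousLinearMap.integral_apply (hS j x), h.unbiased_jac]
    rfl
  -- Evaluation at a unit vector does not increase the norm, so each column inherits the variance
  -- bound of the Jacobian.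
  · refine le_trans (lintegral_mono fun ω => ?_) (h.variance_jac (n + 1) j x)
    gcongr
    rw [enorm_le_iff_norm_le]
    have := (fderiv ℝ (g (S.jac (n + 1) j ω)) x - meanJac Pw g x).le_opNorm e
    rwa [he1, mul_one] at this

end Noise

/-! ### Rates, recursions and summation of real sequences. -/

section RealSequences

/-- Fifth roots of natural numbers; all rates in the analysis are powers of these. -/
noncomputable def fifthRoot (t : ℕ) : ℝ := (t : ℝ) ^ (1 / 5 : ℝ)

theorem fifthRoot_nonneg (t : ℕ) : 0 ≤ fifthRoot t := by unfold fifthRoot; positivity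

theorem fifthRoot_pos {t : ℕ} (ht : 0 < t) : 0 < fifthRoot t := by unfold fifthRoot; positivity

theorem one_le_fifthRoot {t : ℕ} (ht : 0 < t) : 1 ≤ fifthRoot t :=
  Real.one_le_rpow (by exact_mod_cast ht) (by norm_num)

theorem fifthRoot_mono {s t : ℕ} (h : s ≤ t) : fifthRoot s ≤ fifthRoot t :=
  Real.rpow_le_rpow (by positivity) (by exact_mod_cast h) (by norm_num)

theorem fifthRoot_pow (t k : ℕ) : fifthRoot t ^ k = (t : ℝ) ^ (k / 5 : ℝ) := by
  rw [fifthRoot, ← Real.rpow_natCast, ← Real.rpow_mul (by positivity)]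
  congr 1
  ring

theorem fifthRoot_pow_five (t : ℕ) : fifthRoot t ^ 5 = t := by
  rw [fifthRoot_pow]
  norm_num

/-- The basic rate `t^(-4/5)` at `t = n + 1`. -/
noncomputable def rate (n : ℕ) : ℝ := (fifthRoot (n + 1) ^ 4)⁻¹

/-- With a and b the fifth roots of t and t + 1, factoring 1 = b⁵ - a⁵ gives 1 ≤ 5 b⁴ (b - a), so
the sum telescopes. -/
theorem sum_rate_le (T : ℕ) : ∑ n ∈ Finset.range T, rate n ≤ 5 * fifthRoot T := by
  induction T with
  | zero => simpa using fifthRoot_nonneg 0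
  | succ T ih =>
    rw [Finset.sum_range_succ]
    have ha := fifthRoot_nonneg T
    have hb := fifthRoot_pos (Nat.succ_pos T)
    have hab := fifthRoot_mono (Nat.le_succ T)
    have h1 : fifthRoot (T + 1) ^ 5 - fifthRoot T ^ 5 = 1 := by
      rw [fifthRoot_pow_five, fifthRoot_pow_five]
      push_cast
      ring
    have h2 : rate T ≤ 5 * (fifthRoot (T + 1) - fifthRoot T) := by
      rw [rate, inv_le_iff_one_le_mul₀ (by positivity)]
      simp only [Nat.succ_eq_add_one] at *
      generalize fifthRoot T = a at *
      generalize fifthRoot (T + 1) = b at *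
      have h3 : a ^ 4 ≤ b ^ 4 := by gcongr
      have h4 : a ^ 3 * b ≤ b ^ 3 * b := by gcongr
      have h5 : a ^ 2 * b ^ 2 ≤ b ^ 2 * b ^ 2 := by gcongr
      have h6 : a * b ^ 3 ≤ b * b ^ 3 := by gcongr
      calc 1 = (b - a) * (b ^ 4 + a * b ^ 3 + a ^ 2 * b ^ 2 + a ^ 3 * b + a ^ 4) := by
            rw [← h1]; ring
        _ ≤ (b - a) * (5 * b ^ 4) := by
            refine mul_le_mul_of_nonneg_left ?_ (by linarith)
            linarith
        _ = _ := by ring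
    linarith

/-- The sequence n μⁿ is bounded, and (n + 1)^(4/5) ≤ n + 1. -/
theorem exists_pow_le_rate {μ : ℝ} (hμ : 0 < μ) (hμ' : μ < 1) :
    ∃ a : ℝ, 0 ≤ a ∧ ∀ n, μ ^ (n + 1) ≤ a * rate n := by
  have h := tendsto_self_mul_const_pow_of_abs_lt_one (r := μ) (by rwa [abs_of_pos hμ])
  obtain ⟨a, ha⟩ := h.bddAbove_range
  have ha' (n : ℕ) : (n : ℝ) * μ ^ n ≤ a := ha ⟨n, rfl⟩
  refine ⟨a, by simpa using ha' 0, fun n => ?_⟩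
  have hb := one_le_fifthRoot (Nat.succ_pos n)
  rw [rate, ← div_eq_mul_inv, le_div_iff₀ (by positivity)]
  refine le_trans ?_ (ha' (n + 1))
  rw [mul_comm, ← fifthRoot_pow_five (n + 1)]
  gcongr
  norm_num

/-- Sequences built from recursive averages with weights that are eventually convex are bounded,
with a bound that depends only on the weights. -/
theorem exists_bound_of_recursion {γ : ℕ → ℝ} {D : ℝ}
    (hγ : ∀ᶠ t in atTop, 0 ≤ γ t ∧ γ t ≤ 1) :
    ∃ B : ℝ, D ≤ B ∧ ∀ b : ℕ → ℝ, b 0 ≤ D →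
      (∀ n, b (n + 1) ≤ |γ (n + 1)| * b n + |1 - γ (n + 1)| * D) → ∀ n, b n ≤ B := by
  -- This is the worst case of the recursion, made monotone by the maximum. Once the weights are
  -- convex, a step averages `c n` with `D ≤ c n`, so growth stops after finitely many indices.
  let c : ℕ → ℝ := fun n => Nat.rec D
    (fun n x => max x (|γ (n + 1)| * x + |1 - γ (n + 1)| * D)) n
  have hc n : c (n + 1) = max (c n) (|γ (n + 1)| * c n + |1 - γ (n + 1)| * D) := rfl
  have hmono : Monotone c := monotone_nat_of_le_succ fun n => by
    rw [hc]
    exact le_max_left _ _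
  obtain ⟨N, hN⟩ := eventually_atTop.1 hγ
  have hD n : D ≤ c n := hmono (Nat.zero_le n)
  have hstab n (hn : N ≤ n) : c n ≤ c N := by
    induction n, hn using Nat.le_induction with
    | base => exact le_rfl
    | succ n hn ih =>
      refine le_trans ?_ ih
      rw [hc]
      refine max_le le_rfl ?_
      obtain ⟨h0, h1⟩ := hN (n + 1) (by omega)
      rw [abs_of_nonneg h0, abs_of_nonneg (by linarith)]
      nlinarith [hD n]
  refine ⟨c N, hD N, fun b hb0 hb n => ?_⟩
  have hbc n : b n ≤ c n := by
    induction n with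
    | zero => exact hb0
    | succ n ih =>
      refine (hb n).trans (le_trans ?_ (le_max_right _ _))
      gcongr
  rcases le_total n N with h | h
  · exact (hbc n).trans (hmono h)
  · exact (hbc n).trans (hstab n h)

/-- Summation by parts: differences of a bounded sequence with increasing weights. -/
theorem sum_weighted_differences_le {J u : ℕ → ℝ} {B : ℝ} (hJ : ∀ n, |J n| ≤ B)
    (hu : Monotone u) (hu0 : ∀ n, 0 ≤ u n) (T : ℕ) :
    ∑ n ∈ Finset.range T, u (n + 1) * (J n - J (n + 1)) ≤ 2 * B * u T := by
  -- Keeping `J T` in the bound lets the induction close: the slack at each step is (u (T+1) - u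
  -- T)(B - J T) ≥ 0.
  have h : ∑ n ∈ Finset.range T, u (n + 1) * (J n - J (n + 1)) ≤ u T * (B - J T) := by
    induction T with
    | zero => simpa using mul_nonneg (hu0 0) (sub_nonneg.2 (abs_le.1 (hJ 0)).2)
    | succ T ih =>
      rw [Finset.sum_range_succ]
      nlinarith [mul_nonneg (sub_nonneg.2 (hu (Nat.le_succ T)))
        (sub_nonneg.2 (abs_le.1 (hJ T)).2)]
  nlinarith [(abs_le.1 (hJ T)).1, hu0 T]

/-- A contracting recursion with summable perturbations. -/
theorem sum_contraction_le {e w : ℕ → ℝ} {β : ℝ} (he : ∀ n, 0 ≤ e n)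
    (h : ∀ n, e (n + 1) ≤ (1 - β) * e n + w n) (T : ℕ) :
    β * ∑ n ∈ Finset.range T, e n ≤ e 0 + ∑ n ∈ Finset.range T, w n := by
  have h' : β * ∑ n ∈ Finset.range T, e n + e T ≤ e 0 + ∑ n ∈ Finset.range T, w n := by
    induction T with
    | zero => simp
    | succ T ih =>
      rw [Finset.sum_range_succ, Finset.sum_range_succ]
      linarith [h T]
  linarith [he T]

/-- The bookkeeping of the proof without probability: `G` stands for squared gradients, `J` for
objective values, `r` for the squared error of the momentum, `e` for the squared tracking error and
the `Nᵢ` for squared sampling errors. Summing `hG` calls for the sum of `r`, which calls for that of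
`e`, which the contraction controls. -/
theorem sum_gradient_le_of_recursions {G J r e N₁ N₂ N₃ : ℕ → ℝ}
    {c₁ c₂ c₃ c₄ c₅ c₆ β B R : ℝ} (hc₁ : 0 ≤ c₁) (hc₂ : 0 ≤ c₂) (hc₃ : 0 ≤ c₃) (hc₄ : 0 ≤ c₄)
    (hc₅ : 0 ≤ c₅) (hc₆ : 0 ≤ c₆) (hβ : 0 < β) (hR : 0 ≤ R) (hJ : ∀ n, |J n| ≤ B)
    (he : ∀ n, 0 ≤ e n) (hN₁ : ∀ n, 0 ≤ N₁ n) (hN₂ : ∀ n, 0 ≤ N₂ n) (hN₃ : ∀ n, 0 ≤ N₃ n)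
    (hG : ∀ n, G n ≤ c₁ * (fifthRoot (n + 1) * (J n - J (n + 1))) + c₂ * r n + c₃ * rate n)
    (hr : ∀ n, r n ≤ c₄ * (N₁ n + N₂ n + e n) + c₅ * rate n)
    (he0 : e 0 ≤ R) (heN : ∀ n, e (n + 1) ≤ (1 - β) * e n + (2 * N₃ n + c₆ * rate n))
    {T : ℕ} (hT : 0 < T) :
    ∑ n ∈ Finset.range T, G n
      ≤ (2 * c₁ * B + 5 * c₃ + c₂ * (5 * c₅ + c₄ * (β⁻¹ * (R + 5 * c₆)))) * fifthRoot T
        + c₂ * c₄ * (1 + 2 * β⁻¹) * ∑ n ∈ Finset.range T, (N₁ n + N₂ n + N₃ n) := by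
  have h1 := sum_weighted_differences_le (u := fifthRoot) hJ (fun _ _ => fifthRoot_mono)
    fifthRoot_nonneg T
  have h2 := sum_rate_le T
  have h3 := sum_contraction_le he heN T
  have hroot := one_le_fifthRoot hT
  have hsG : ∑ n ∈ Finset.range T, G n
      ≤ c₁ * ∑ n ∈ Finset.range T, fifthRoot (n + 1) * (J n - J (n + 1))
        + c₂ * ∑ n ∈ Finset.range T, r n + c₃ * ∑ n ∈ Finset.range T, rate n := by
    simp only [Finset.mul_sum, ← Finset.sum_add_distrib]
    exact Finset.sum_le_sum fun n _ => hG n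
  have hsr : ∑ n ∈ Finset.range T, r n
      ≤ c₄ * (∑ n ∈ Finset.range T, N₁ n + ∑ n ∈ Finset.range T, N₂ n
        + ∑ n ∈ Finset.range T, e n) + c₅ * ∑ n ∈ Finset.range T, rate n := by
    simp only [Finset.mul_sum, ← Finset.sum_add_distrib]
    exact Finset.sum_le_sum fun n _ => hr n
  rw [Finset.sum_add_distrib, ← Finset.mul_sum, ← Finset.mul_sum] at h3
  simp only [Finset.sum_add_distrib]
  have hs₁ := Finset.sum_nonneg fun n (_ : n ∈ Finset.range T) => hN₁ n
  have hs₂ := Finset.sum_nonneg fun n (_ : n ∈ Finset.range T) => hN₂ n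
  have hs₃ := Finset.sum_nonneg fun n (_ : n ∈ Finset.range T) => hN₃ n
  generalize ∑ n ∈ Finset.range T, N₁ n = s₁ at *
  generalize ∑ n ∈ Finset.range T, N₂ n = s₂ at *
  generalize ∑ n ∈ Finset.range T, N₃ n = s₃ at *
  generalize ∑ n ∈ Finset.range T, e n = se at *
  generalize ∑ n ∈ Finset.range T, r n = sr at *
  generalize ∑ n ∈ Finset.range T, rate n = sw at *
  generalize fifthRoot T = b at *
  have hβ' : 0 < β⁻¹ := inv_pos.2 hβ
  have hse : se ≤ β⁻¹ * ((R + 5 * c₆) * b + 2 * s₃) := by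
    rw [← div_eq_inv_mul, le_div_iff₀' hβ]
    calc β * se ≤ R * 1 + (2 * s₃ + c₆ * (5 * b)) := by
          rw [mul_one]
          exact h3.trans (by gcongr)
      _ ≤ R * b + (2 * s₃ + c₆ * (5 * b)) := by gcongr
      _ = _ := by ring
  have hβs : 0 ≤ β⁻¹ * (s₁ + s₂) := by positivity
  calc _ ≤ c₁ * (2 * B * b) + c₂ * (c₄ * (s₁ + s₂ + β⁻¹ * ((R + 5 * c₆) * b + 2 * s₃))
        + c₅ * (5 * b)) + c₃ * (5 * b) := by
        refine hsG.trans ?_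
        gcongr
        refine hsr.trans ?_
        gcongr
    _ = (2 * c₁ * B + 5 * c₃ + c₂ * (5 * c₅ + c₄ * (β⁻¹ * (R + 5 * c₆)))) * b
        + c₂ * c₄ * (s₁ + s₂ + 2 * β⁻¹ * s₃) := by ring
    _ ≤ (2 * c₁ * B + 5 * c₃ + c₂ * (5 * c₅ + c₄ * (β⁻¹ * (R + 5 * c₆)))) * b
        + c₂ * c₄ * ((1 + 2 * β⁻¹) * (s₁ + s₂ + s₃)) := by
        gcongr
        linarith
    _ = _ := by ring

end RealSequences

/-! ### Deterministic inequalities for a single update. -/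

section Step

variable {p q : ℕ}

/-- Completing the square in each coordinate and dropping -m²/(2d) leaves (m - G)²/(2d) - G²/(2d).
The lower bound ε on the denominator serves the first term, the upper bound `D` the second. -/
theorem inner_step_le {x x' m v G : EuclideanSpace ℝ (Fin p)} {α ε D : ℝ} (hα : 0 ≤ α)
    (hε : 0 < ε) (hx' : ∀ i, x' i - x i = -(α * (m i / (Real.sqrt (v i) + ε))))
    (hD : ∀ i, Real.sqrt (v i) + ε ≤ D) :
    inner ℝ G (x' - x) ≤ α * (‖m - G‖ ^ 2 / (2 * ε) - ‖G‖ ^ 2 / (2 * D)) := by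
  rw [PiLp.inner_apply, EuclideanSpace.real_norm_sq_eq, EuclideanSpace.real_norm_sq_eq,
    Finset.sum_div, Finset.sum_div, ← Finset.sum_sub_distrib, Finset.mul_sum]
  refine Finset.sum_le_sum fun i _ => ?_
  have hd : 0 < Real.sqrt (v i) + ε := by positivity
  have hed : ε ≤ Real.sqrt (v i) + ε := by linarith [Real.sqrt_nonneg (v i)]
  have hi := hD i
  simp only [PiLp.sub_apply, RCLike.inner_apply, conj_trivial, hx']
  generalize Real.sqrt (v i) + ε = d at *
  have h1 : (m i - G i) ^ 2 / (2 * d) ≤ (m i - G i) ^ 2 / (2 * ε) := by gcongr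
  have h2 : G i ^ 2 / (2 * D) ≤ G i ^ 2 / (2 * d) := by gcongr
  have h3 : -(m i / d) * G i ≤ (m i - G i) ^ 2 / (2 * d) - G i ^ 2 / (2 * d) := by
    rw [← sub_div, neg_mul, div_mul_eq_mul_div, ← neg_div, div_le_div_iff₀ hd (by positivity)]
    nlinarith [mul_nonneg hd.le (sq_nonneg (m i))]
  calc -(α * (m i / d)) * G i = α * (-(m i / d) * G i) := by ring
    _ ≤ _ := mul_le_mul_of_nonneg_left (by linarith) hα

theorem norm_step_le {x x' m v : EuclideanSpace ℝ (Fin p)} {α ε : ℝ} (hα : 0 ≤ α)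
    (hε : 0 < ε) (hx' : ∀ i, x' i - x i = -(α * (m i / (Real.sqrt (v i) + ε)))) :
    ‖x' - x‖ ^ 2 ≤ (α / ε) ^ 2 * ‖m‖ ^ 2 := by
  rw [EuclideanSpace.real_norm_sq_eq, EuclideanSpace.real_norm_sq_eq, Finset.mul_sum]
  refine Finset.sum_le_sum fun i _ => ?_
  have hd : 0 < Real.sqrt (v i) + ε := by positivity
  have hed : ε ≤ Real.sqrt (v i) + ε := by linarith [Real.sqrt_nonneg (v i)]
  simp only [PiLp.sub_apply, hx']
  generalize Real.sqrt (v i) + ε = d at *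
  calc (-(α * (m i / d))) ^ 2 = (α / d) ^ 2 * m i ^ 2 := by ring
    _ ≤ _ := by gcongr

/-- A linear term in a small quantity is dominated by a constant plus a quartic term. -/
theorem le_const_add_quartic {s c : ℝ} (hs : 0 ≤ s) (hc : 0 < c) : s ≤ c + s ^ 4 / c ^ 3 := by
  rcases le_total s c with h | h
  · have : 0 ≤ s ^ 4 / c ^ 3 := by positivity
    linarith
  · have : s ≤ s ^ 4 / c ^ 3 := by
      rw [le_div_iff₀ (by positivity)]
      calc s * c ^ 3 ≤ s * s ^ 3 := by gcongr
        _ = s ^ 4 := by ring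
    linarith

theorem norm_add_sq_le {E : Type*} [SeminormedAddCommGroup E] (a b : E) :
    ‖a + b‖ ^ 2 ≤ 2 * ‖a‖ ^ 2 + 2 * ‖b‖ ^ 2 := by
  have := norm_add_le a b
  have h : ‖a + b‖ ^ 2 ≤ (‖a‖ + ‖b‖) ^ 2 := by gcongr
  nlinarith [sq_nonneg (‖a‖ - ‖b‖)]

/-- The gradient bound that one step of the method with step size `Cα / b` yields. -/
theorem norm_gradient_sq_le_of_step {x x' m v G : EuclideanSpace ℝ (Fin p)}
    {Cα b ε D M L J J' : ℝ} (hCα : 0 < Cα) (hb : 1 ≤ b) (hε : 0 < ε) (hD0 : 0 < D) (hL : 0 ≤ L)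
    (hx' : ∀ i, x' i - x i = -(Cα / b * (m i / (Real.sqrt (v i) + ε))))
    (hD : ∀ i, Real.sqrt (v i) + ε ≤ D) (hG : ‖G‖ ≤ M)
    (hJ : J' ≤ J + inner ℝ G (x' - x) + L * ‖x' - x‖ ^ 2) :
    ‖G‖ ^ 2 ≤ 4 * D / Cα * (b * (J - J'))
      + 4 * D * (1 / (2 * ε) + 2 * L * Cα / ε ^ 2) * ‖m - G‖ ^ 2
      + 4 * D * ((2 * L * Cα / ε ^ 2) ^ 4 * (4 * D) ^ 3 * M ^ 2) * (b ^ 4)⁻¹ := by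
  have hb0 : 0 < b := by linarith
  have h1 := inner_step_le (G := G) (by positivity : 0 ≤ Cα / b) hε hx' hD
  have h2 := norm_step_le (by positivity : 0 ≤ Cα / b) hε hx'
  have h3 : ‖m‖ ^ 2 ≤ 2 * ‖m - G‖ ^ 2 + 2 * ‖G‖ ^ 2 := by
    simpa using norm_add_sq_le (m - G) G
  set k := 2 * L * Cα / ε ^ 2 with hk
  have hk0 : 0 ≤ k := by positivity
  have h4 : L * ‖x' - x‖ ^ 2 ≤ Cα / b * (k / b * (‖m - G‖ ^ 2 + ‖G‖ ^ 2)) := by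
    calc L * ‖x' - x‖ ^ 2 ≤ L * ((Cα / b / ε) ^ 2 * (2 * ‖m - G‖ ^ 2 + 2 * ‖G‖ ^ 2)) := by
          gcongr
          exact h2.trans (by gcongr)
      _ = _ := by rw [hk]; field_simp
  -- The smoothness error is of order ‖G‖²/b, and a bound by b⁻¹ would sum to T^(4/5). With c =
  -- 1/(4D), half of the descent term ‖G‖²/(2D) absorbs its main part, and the rest decays like b⁻⁴.
  have h5 := le_const_add_quartic (s := k / b) (c := 1 / (4 * D)) (by positivity) (by positivity)
  have h6 : k / b * ‖G‖ ^ 2 ≤ ‖G‖ ^ 2 / (4 * D) + k ^ 4 * (4 * D) ^ 3 * M ^ 2 * (b ^ 4)⁻¹ := by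
    calc k / b * ‖G‖ ^ 2 ≤ (1 / (4 * D) + (k / b) ^ 4 / (1 / (4 * D)) ^ 3) * ‖G‖ ^ 2 := by
          gcongr
      _ = ‖G‖ ^ 2 / (4 * D) + k ^ 4 * (4 * D) ^ 3 * ‖G‖ ^ 2 * (b ^ 4)⁻¹ := by
          field_simp
      _ ≤ _ := by gcongr
  have h7 : k / b * ‖m - G‖ ^ 2 ≤ k * ‖m - G‖ ^ 2 := by
    gcongr
    exact div_le_self hk0 hb
  have h8 : J' - J ≤ Cα / b * (‖m - G‖ ^ 2 / (2 * ε) - ‖G‖ ^ 2 / (2 * D)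
      + k * ‖m - G‖ ^ 2 + (‖G‖ ^ 2 / (4 * D) + k ^ 4 * (4 * D) ^ 3 * M ^ 2 * (b ^ 4)⁻¹)) := by
    calc J' - J ≤ Cα / b * (‖m - G‖ ^ 2 / (2 * ε) - ‖G‖ ^ 2 / (2 * D))
          + Cα / b * (k / b * (‖m - G‖ ^ 2 + ‖G‖ ^ 2)) := by linarith
      _ = Cα / b * (‖m - G‖ ^ 2 / (2 * ε) - ‖G‖ ^ 2 / (2 * D)
          + k / b * ‖m - G‖ ^ 2 + k / b * ‖G‖ ^ 2) := by ring
      _ ≤ _ := by gcongr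
  have h9 : 4 * D * (b / Cα) * (J' - J) ≤ 4 * D * (b / Cα) * (Cα / b * (‖m - G‖ ^ 2 / (2 * ε)
      - ‖G‖ ^ 2 / (2 * D) + k * ‖m - G‖ ^ 2
      + (‖G‖ ^ 2 / (4 * D) + k ^ 4 * (4 * D) ^ 3 * M ^ 2 * (b ^ 4)⁻¹))) := by gcongr
  have h10 : 4 * D * (b / Cα) * (Cα / b * (‖m - G‖ ^ 2 / (2 * ε)
      - ‖G‖ ^ 2 / (2 * D) + k * ‖m - G‖ ^ 2
      + (‖G‖ ^ 2 / (4 * D) + k ^ 4 * (4 * D) ^ 3 * M ^ 2 * (b ^ 4)⁻¹)))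
      = - ‖G‖ ^ 2 + 4 * D * (1 / (2 * ε) + k) * ‖m - G‖ ^ 2
        + 4 * D * (k ^ 4 * (4 * D) ^ 3 * M ^ 2) * (b ^ 4)⁻¹ := by
    field_simp
    ring
  have h11 : 4 * D * (b / Cα) * (J' - J) = - (4 * D / Cα * (b * (J - J'))) := by
    field_simp
    ring
  linarith

/-- One step of the tracking error of the auxiliary variable `y`. -/
theorem norm_tracking_sq_le {E F : Type*} [NormedAddCommGroup E] [NormedSpace ℝ E]
    [NormedAddCommGroup F] [InnerProductSpace ℝ F] {g : E → F} {Dg : E → E →L[ℝ] F} {L β : ℝ}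
    (hβ : 0 < β) (hβ' : β < 1)
    (hg : ∀ x y, ‖g y - g x - Dg x (y - x)‖ ≤ L * ‖y - x‖ ^ 2) {x x' z : E}
    (hz : z = (1 - 1 / β) • x + (1 / β) • x') {y y' a : F} (hy : y' = (1 - β) • y + β • a) :
    ‖y' - g x'‖ ^ 2 ≤ (1 - β) * ‖y - g x‖ ^ 2
      + (2 * ‖a - g z‖ ^ 2 + 2 * (L * (1 / β + 1) / β) ^ 2 * (‖x' - x‖ ^ 2) ^ 2) := by
  have hzx : z - x = (1 / β) • (x' - x) := by
    rw [hz]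
    module
  -- As z - x = (x' - x)/β, the linear terms cancel and only two second-order remainders are left.
  -- This is the purpose of the extrapolation.
  set h : F := (g z - g x - Dg x (z - x)) - (1 / β) • (g x' - g x - Dg x (x' - x)) with hh
  have hnorm : ‖h‖ ≤ L * (1 / β + 1) / β * ‖x' - x‖ ^ 2 := by
    calc ‖h‖ ≤ ‖g z - g x - Dg x (z - x)‖ + ‖(1 / β) • (g x' - g x - Dg x (x' - x))‖ :=
          norm_sub_le _ _
      _ ≤ L * ‖z - x‖ ^ 2 + 1 / β * (L * ‖x' - x‖ ^ 2) := by
          rw [norm_smul, Real.norm_of_nonneg (by positivity : 0 ≤ 1 / β)]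
          gcongr
          · exact hg x z
          · exact hg x x'
      _ = _ := by
          rw [hzx, norm_smul, Real.norm_of_nonneg (by positivity : 0 ≤ 1 / β)]
          field_simp
  have heq : y' - g x' = (1 - β) • (y - g x) + β • ((a - g z) + h) := by
    rw [hy, hh, hzx, map_smul]
    match_scalars <;> field_simp <;> ring
  -- Convexity of the square keeps the contraction factor at exactly 1 - β; the factor 2 is spent
  -- only on the perturbation.
  have hconv : ‖y' - g x'‖ ^ 2 ≤ (1 - β) * ‖y - g x‖ ^ 2 + β * ‖(a - g z) + h‖ ^ 2 := by
    have h1 : ‖y' - g x'‖ ≤ (1 - β) * ‖y - g x‖ + β * ‖(a - g z) + h‖ := by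
      rw [heq]
      refine (norm_add_le _ _).trans ?_
      rw [norm_smul, norm_smul, Real.norm_of_nonneg hβ.le, Real.norm_of_nonneg (by linarith)]
    have h2 : ‖y' - g x'‖ ^ 2 ≤ ((1 - β) * ‖y - g x‖ + β * ‖(a - g z) + h‖) ^ 2 := by gcongr
    nlinarith [mul_nonneg (mul_nonneg hβ.le (sub_nonneg.2 hβ'.le))
      (sq_nonneg (‖y - g x‖ - ‖(a - g z) + h‖))]
  have h3 := norm_add_sq_le (a - g z) h
  have h4 : ‖h‖ ^ 2 ≤ (L * (1 / β + 1) / β) ^ 2 * (‖x' - x‖ ^ 2) ^ 2 := by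
    rw [← mul_pow]
    gcongr
  have h5 : β * ‖(a - g z) + h‖ ^ 2 ≤ 1 * ‖(a - g z) + h‖ ^ 2 := by gcongr
  linarith

end Step

theorem norm_batchMean_le {E : Type*} [NormedAddCommGroup E] [NormedSpace ℝ E] {F : ℕ → E} {c : ℝ}
    (hc : 0 ≤ c) (h : ∀ j, ‖F j‖ ≤ c) (K : ℕ) : ‖batchMean K F‖ ≤ c := by
  rw [batchMean, norm_smul, norm_inv, Real.norm_natCast]
  rcases Nat.eq_zero_or_pos K with rfl | hK
  · simpa using hc
  · rw [inv_mul_le_iff₀ (by positivity)]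
    refine (norm_sum_le _ _).trans ((Finset.sum_le_sum fun j _ => h j).trans ?_)
    simp

/-! ### Error of the stochastic direction. -/

section Pathwise

variable {p q : ℕ} {Ω V W : Type u} [MeasurableSpace V] [MeasurableSpace W] {Pv : Measure V}
  {Pw : Measure W} {A : Params} {f : V → EuclideanSpace ℝ (Fin q) → ℝ}
  {g : W → EuclideanSpace ℝ (Fin p) → EuclideanSpace ℝ (Fin q)} {Bf Mf Lf Mg Lg : ℝ}
  {S : Samples Ω V W}

theorem norm_jacMean_le (hr : Regular Pw f g Bf Mf Lf Mg Lg) (hMg : 0 ≤ Mg) (t : ℕ)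
    (x : EuclideanSpace ℝ (Fin p)) (ω : Ω) : ‖jacMean A g S t x ω‖ ≤ Mg :=
  norm_batchMean_le hMg (fun _ => hr.norm_fderiv_g_le hMg _ x) _

theorem norm_gradMean_le (hr : Regular Pw f g Bf Mf Lf Mg Lg) (hMf : 0 ≤ Mf) (t : ℕ)
    (y : EuclideanSpace ℝ (Fin q)) (ω : Ω) : ‖gradMean A f S t y ω‖ ≤ Mf :=
  norm_batchMean_le hMf (fun _ => hr.bounded_grad_f _ y) _

theorem norm_direction_le (hr : Regular Pw f g Bf Mf Lf Mg Lg) (hMf : 0 ≤ Mf) (hMg : 0 ≤ Mg)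
    (t : ℕ) (s : State p q) (ω : Ω) : ‖direction A f g S t s ω‖ ≤ Mg * Mf := by
  refine (ContinuousLinearMap.le_opNorm _ _).trans ?_
  rw [LinearIsometryEquiv.norm_map]
  exact mul_le_mul (norm_jacMean_le hr hMg t _ ω) (norm_gradMean_le hr hMf t _ ω)
    (norm_nonneg _) hMg

variable [IsProbabilityMeasure Pv] [IsProbabilityMeasure Pw]

/-- The error of the stochastic direction in terms of the sampling errors and of the tracking
error. -/
theorem norm_direction_sub_gradient_sq_le (hr : Regular Pw f g Bf Mf Lf Mg Lg) (hMf : 0 ≤ Mf)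
    (hMg : 0 ≤ Mg) (t : ℕ) (s : State p q) (ω : Ω) :
    ‖direction A f g S t s ω - gradient (objective Pv Pw f g) s.x‖ ^ 2
      ≤ 3 * (Mf ^ 2 + Mg ^ 2 + (Mg * Lf) ^ 2)
        * (‖jacMean A g S t s.x ω - meanJac Pw g s.x‖ ^ 2
          + ‖gradMean A f S t s.y ω - meanGrad Pv f s.y‖ ^ 2
          + ‖s.y - innerMap Pw g s.x‖ ^ 2) := by
  have h1 := norm_adjoint_apply_sub_le (jacMean A g S t s.x ω) (meanJac Pw g s.x)
    (gradMean A f S t s.y ω) (meanGrad Pv f (innerMap Pw g s.x))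
  have h2 : ‖gradMean A f S t s.y ω - meanGrad Pv f (innerMap Pw g s.x)‖
      ≤ ‖gradMean A f S t s.y ω - meanGrad Pv f s.y‖ + Lf * ‖s.y - innerMap Pw g s.x‖ := by
    refine (norm_sub_le_norm_sub_add_norm_sub _ (meanGrad Pv f s.y) _).trans ?_
    gcongr
    exact hr.norm_meanGrad_sub_le _ _
  rw [hr.gradient_objective hMg]
  set a := ‖jacMean A g S t s.x ω - meanJac Pw g s.x‖
  set b := ‖gradMean A f S t s.y ω - meanGrad Pv f s.y‖
  set c := ‖s.y - innerMap Pw g s.x‖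
  have h3 : ‖direction A f g S t s ω - ContinuousLinearMap.adjoint (meanJac Pw g s.x)
      (meanGrad Pv f (innerMap Pw g s.x))‖ ≤ a * Mf + Mg * (b + Lf * c) := by
    refine h1.trans ?_
    gcongr
    · exact norm_gradMean_le hr hMf t _ ω
    · exact hr.norm_meanJac_le hMg _
  calc _ ≤ (a * Mf + Mg * (b + Lf * c)) ^ 2 := by gcongr
    _ ≤ 3 * (Mf ^ 2 * a ^ 2 + Mg ^ 2 * b ^ 2 + (Mg * Lf) ^ 2 * c ^ 2) := by
        nlinarith [sq_nonneg (a * Mf - Mg * b), sq_nonneg (a * Mf - Mg * Lf * c),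
          sq_nonneg (Mg * b - Mg * Lf * c)]
    _ ≤ 3 * ((Mf ^ 2 + Mg ^ 2 + (Mg * Lf) ^ 2) * a ^ 2 + (Mf ^ 2 + Mg ^ 2 + (Mg * Lf) ^ 2) * b ^ 2
        + (Mf ^ 2 + Mg ^ 2 + (Mg * Lf) ^ 2) * c ^ 2) := by
        gcongr <;> nlinarith [sq_nonneg Mf, sq_nonneg Mg, sq_nonneg (Mg * Lf)]
    _ = _ := by ring

end Pathwise

/-! ### Properties of the parameter schedule. -/

section Schedule

variable {ε Cα Cβ C₁ C₂ C₃ Cγ μ : ℝ}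

/-- For large constants the early weights can leave [0, 1]. The boundedness of the recursive
averages only needs them to be there eventually. -/
theorem schedule_γ₁_eventually (hCγ : 0 < Cγ) (hμ : 0 < μ) (hμ' : μ < 1) :
    ∀ᶠ t in atTop, 0 ≤ (schedule ε Cα Cβ C₁ C₂ C₃ Cγ μ).γ₁ t ∧
      (schedule ε Cα Cβ C₁ C₂ C₃ Cγ μ).γ₁ t ≤ 1 := by
  have h : Tendsto (fun t : ℕ => Cγ * μ ^ t) atTop (𝓝 (Cγ * 0)) :=
    (tendsto_pow_atTop_nhds_zero_of_lt_one hμ.le hμ').const_mul Cγ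
  rw [mul_zero] at h
  filter_upwards [h.eventually_le_const zero_lt_one] with t ht
  exact ⟨mul_nonneg hCγ.le (pow_nonneg hμ.le t), ht⟩

theorem schedule_γ₂_eventually (hCα : 0 < Cα) (hμ : 0 < μ) (hμ' : μ < 1) :
    ∀ᶠ t in atTop, 0 ≤ (schedule ε Cα Cβ C₁ C₂ C₃ Cγ μ).γ₂ t ∧
      (schedule ε Cα Cβ C₁ C₂ C₃ Cγ μ).γ₂ t ≤ 1 := by
  have h1 : Tendsto (fun t : ℕ => (1 - Cγ * μ ^ t) ^ 2) atTop (𝓝 ((1 - Cγ * 0) ^ 2)) :=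
    (((tendsto_pow_atTop_nhds_zero_of_lt_one hμ.le hμ').const_mul Cγ).const_sub 1).pow 2
  have h2 : Tendsto (fun t : ℕ => Cα / (t : ℝ) ^ (2 / 5 : ℝ)) atTop (𝓝 0) :=
    ((tendsto_rpow_atTop (by norm_num : (0 : ℝ) < 2 / 5)).comp
      tendsto_natCast_atTop_atTop).const_div_atTop Cα
  have h := h2.mul h1
  rw [zero_mul] at h
  filter_upwards [h.eventually_le_const zero_lt_one] with t ht
  have h0 : 0 ≤ Cα / (t : ℝ) ^ (2 / 5 : ℝ) * (1 - Cγ * μ ^ t) ^ 2 := by positivity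
  exact ⟨sub_nonneg.2 ht, sub_le_self 1 h0⟩

theorem mul_fifthRoot_le_ceil (c : ℝ) (t : ℕ) :
    c * fifthRoot t ^ 4 ≤ (⌈c * (t : ℝ) ^ (4 / 5 : ℝ)⌉₊ : ℝ) := by
  rw [fifthRoot_pow]
  exact_mod_cast Nat.le_ceil _

theorem ceil_pos {c : ℝ} (hc : 0 < c) (n : ℕ) :
    0 < ⌈c * ((n + 1 : ℕ) : ℝ) ^ (4 / 5 : ℝ)⌉₊ :=
  Nat.ceil_pos.2 (by positivity)

theorem div_ceil_le {c : ℝ} (hc : 0 < c) {a : ℝ} (ha : 0 ≤ a) (n : ℕ) :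
    a / (⌈c * ((n + 1 : ℕ) : ℝ) ^ (4 / 5 : ℝ)⌉₊ : ℝ) ≤ a / c * rate n := by
  have hb := fifthRoot_pos (Nat.succ_pos n)
  rw [rate, ← div_eq_mul_inv, div_div]
  gcongr
  exact mul_fifthRoot_le_ceil c (n + 1)

/-- The number of oracle calls is of order `T^(9/5)`. -/
theorem oracleCalls_le (hC₁ : 0 ≤ C₁) (hC₂ : 0 ≤ C₂) (hC₃ : 0 ≤ C₃) (T : ℕ) :
    ((schedule ε Cα Cβ C₁ C₂ C₃ Cγ μ).oracleCalls T : ℝ)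
      ≤ (C₁ + C₂ + C₃ + 3) * (T : ℝ) ^ (9 / 5 : ℝ) := by
  have hK {c : ℝ} (hc : 0 ≤ c) {t : ℕ} (ht : t ∈ Finset.Icc 1 T) :
      (⌈c * (t : ℝ) ^ (4 / 5 : ℝ)⌉₊ : ℝ) ≤ (c + 1) * (T : ℝ) ^ (4 / 5 : ℝ) := by
    obtain ⟨h1, h2⟩ := Finset.mem_Icc.1 ht
    have hT : (1 : ℝ) ≤ (T : ℝ) ^ (4 / 5 : ℝ) :=
      Real.one_le_rpow (by exact_mod_cast h1.trans h2) (by norm_num)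
    have htT : (t : ℝ) ^ (4 / 5 : ℝ) ≤ (T : ℝ) ^ (4 / 5 : ℝ) :=
      Real.rpow_le_rpow (by positivity) (by exact_mod_cast h2) (by norm_num)
    have := (Nat.ceil_lt_add_one (by positivity : 0 ≤ c * (t : ℝ) ^ (4 / 5 : ℝ))).le
    nlinarith
  rw [Params.oracleCalls]
  push_cast
  calc _ ≤ ∑ t ∈ Finset.Icc 1 T, (C₁ + C₂ + C₃ + 3) * (T : ℝ) ^ (4 / 5 : ℝ) := by
        refine Finset.sum_le_sum fun t ht => ?_
        have h1 := hK hC₁ ht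
        have h2 := hK hC₂ ht
        have h3 := hK hC₃ ht
        simp only [schedule]
        linarith
    _ = (C₁ + C₂ + C₃ + 3) * ((T : ℝ) ^ (4 / 5 : ℝ) * T) := by
        simp
        ring
    _ = _ := by
        rcases Nat.eq_zero_or_pos T with rfl | hT
        · norm_num
        · rw [← Real.rpow_add_one (by positivity)]
          norm_num

end Schedule

/-! ### Assembly of the pathwise estimate. -/

/-- The pathwise bound: along every run, the sum of the squared gradient norms is controlled by
`T^(1/5)` and by the accumulated squared sampling errors. -/
theorem exists_pathwise_bound (p q : ℕ) {Bf Mf Lf Mg Lg R ε Cα Cβ Cγ μ : ℝ} (C₁ C₂ C₃ : ℝ)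
    (hMf : 0 ≤ Mf) (hLf : 0 ≤ Lf) (hMg : 0 ≤ Mg) (hLg : 0 ≤ Lg)
    (hε : 0 < ε) (hCα : 0 < Cα) (hCβ : 0 < Cβ) (hCβ' : Cβ < 1)
    (hCγ : 0 < Cγ) (hμ : 0 < μ) (hμ' : μ < 1) :
    ∃ a b : ℝ, 0 ≤ b ∧ ∀ (Ω V W : Type u) [MeasurableSpace V] [MeasurableSpace W]
      (Pv : Measure V) (Pw : Measure W) [IsProbabilityMeasure Pv] [IsProbabilityMeasure Pw]
      (f : V → EuclideanSpace ℝ (Fin q) → ℝ)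
      (g : W → EuclideanSpace ℝ (Fin p) → EuclideanSpace ℝ (Fin q))
      (S : Samples Ω V W) (x₁ : EuclideanSpace ℝ (Fin p)) (A : Params),
      A = schedule ε Cα Cβ C₁ C₂ C₃ Cγ μ →
      Regular Pw f g Bf Mf Lf Mg Lg → ‖innerMap Pw g x₁‖ ≤ R → ∀ (ω : Ω) (T : ℕ), 0 < T →
      ∑ n ∈ Finset.range T, ‖gradient (objective Pv Pw f g) (run A f g S x₁ ω n).x‖ ^ 2
        ≤ a * fifthRoot T + b * ∑ n ∈ Finset.range T,
          (‖jacMean A g S (n + 1) (run A f g S x₁ ω n).x ω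
              - meanJac Pw g (run A f g S x₁ ω n).x‖ ^ 2
            + ‖gradMean A f S (n + 1) (run A f g S x₁ ω n).y ω
              - meanGrad Pv f (run A f g S x₁ ω n).y‖ ^ 2
            + ‖valMean A g S (n + 1) (run A f g S x₁ ω (n + 1)).z ω
              - innerMap Pw g (run A f g S x₁ ω (n + 1)).z‖ ^ 2) := by
  set D₀ := Mg * Mf with hD₀
  have hD₀' : 0 ≤ D₀ := by positivity
  -- `M` and `B` are chosen from the weights and `D₀` alone, before any probability space or sample
  -- path, as uniformity of the final constant requires.
  obtain ⟨M, hM, hMb⟩ := exists_bound_of_recursion (D := D₀)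
    (schedule_γ₁_eventually (ε := ε) (Cα := Cα) (Cβ := Cβ) (C₁ := C₁) (C₂ := C₂) (C₃ := C₃)
      hCγ hμ hμ')
  obtain ⟨B, hB, hBb⟩ := exists_bound_of_recursion (D := D₀ ^ 2)
    (schedule_γ₂_eventually (ε := ε) (Cα := Cα) (Cβ := Cβ) (C₁ := C₁) (C₂ := C₂) (C₃ := C₃)
      (Cγ := Cγ) hCα hμ hμ')
  obtain ⟨aμ, haμ, hμr⟩ := exists_pow_le_rate hμ hμ'
  set D := Real.sqrt B + ε with hD
  have hD0 : 0 < D := by positivity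
  set L := Lg * Mf + Mg * (Lf * Mg) with hL
  have hL0 : 0 ≤ L := by positivity
  have hM0 : 0 ≤ M := hD₀'.trans hM
  set c₁ := 4 * D / Cα
  set c₂ := 4 * D * (1 / (2 * ε) + 2 * L * Cα / ε ^ 2)
  set c₃ := 4 * D * ((2 * L * Cα / ε ^ 2) ^ 4 * (4 * D) ^ 3 * D₀ ^ 2)
  set c₄ := 2 * (3 * (Mf ^ 2 + Mg ^ 2 + (Mg * Lf) ^ 2))
  set c₅ := 2 * ((M + D₀) ^ 2 * Cγ ^ 2 * aμ)
  set c₆ := 2 * (Lg * (1 / Cβ + 1) / Cβ) ^ 2 * ((Cα / ε) ^ 4 * M ^ 4)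
  refine ⟨2 * c₁ * Bf + 5 * c₃ + c₂ * (5 * c₅ + c₄ * (Cβ⁻¹ * (R ^ 2 + 5 * c₆))),
    c₂ * c₄ * (1 + 2 * Cβ⁻¹), by positivity, ?_⟩
  intro Ω V W _ _ Pv Pw _ _ f g S x₁ A hA hr hR ω T hT
  set s : ℕ → State p q := run A f g S x₁ ω with hs
  have hstep n : s (n + 1) = step A f g S ω (n + 1) (s n) := rfl
  set d : ℕ → EuclideanSpace ℝ (Fin p) := fun n => direction A f g S (n + 1) (s n) ω with hd
  have hdb n : ‖d n‖ ≤ D₀ := norm_direction_le hr hMf hMg (n + 1) (s n) ω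
  have hm n : (s (n + 1)).m = A.γ₁ (n + 1) • (s n).m + (1 - A.γ₁ (n + 1)) • d n := rfl
  have hv n i : (s (n + 1)).v i = A.γ₂ (n + 1) * (s n).v i + (1 - A.γ₂ (n + 1)) * d n i ^ 2 := rfl
  have hx n i : (s (n + 1)).x i - (s n).x i = -(Cα / fifthRoot (n + 1) *
      ((s (n + 1)).m i / (Real.sqrt ((s (n + 1)).v i) + ε))) := by
    have : (s (n + 1)).x i = (s n).x i - A.α (n + 1) *
      ((s (n + 1)).m i / (Real.sqrt ((s (n + 1)).v i) + A.ε)) := rfl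
    rw [this, hA]
    simp only [schedule, fifthRoot]
    ring
  have hmb n : ‖(s n).m‖ ≤ M := by
    refine hMb (fun n => ‖(s n).m‖) ?_ (fun n => ?_) n
    · change ‖(0 : EuclideanSpace ℝ (Fin p))‖ ≤ _
      simpa using hD₀'
    · rw [hm, ← hA]
      refine (norm_add_le _ _).trans ?_
      rw [norm_smul, norm_smul, Real.norm_eq_abs, Real.norm_eq_abs]
      gcongr
      exact hdb n
  -- Absolute values are needed because a negative early γ₂ can make entries of v negative; the
  -- square root is then 0 and the denominator is still at least ε.
  have hvb i n : |(s n).v i| ≤ B := by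
    refine hBb (fun n => |(s n).v i|) ?_ (fun n => ?_) n
    · change |(0 : ℝ)| ≤ _
      simpa using sq_nonneg D₀
    · change |(s (n + 1)).v i| ≤ _
      rw [hv, ← hA]
      refine (abs_add_le _ _).trans ?_
      rw [abs_mul, abs_mul, abs_of_nonneg (sq_nonneg (d n i))]
      have : d n i ^ 2 ≤ D₀ ^ 2 := by
        rw [← sq_abs]
        gcongr
        exact (PiLp.norm_apply_le (d n) i).trans (hdb n)
      gcongr
  have hden n i : Real.sqrt ((s n).v i) + ε ≤ D := by
    rw [hD]
    gcongr
    exact (le_abs_self _).trans (hvb i n)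
  have hroot n := one_le_fifthRoot (Nat.succ_pos n)
  refine sum_gradient_le_of_recursions
    (J := fun n => objective Pv Pw f g (s n).x)
    (r := fun n => ‖(s (n + 1)).m - gradient (objective Pv Pw f g) (s n).x‖ ^ 2)
    (e := fun n => ‖(s n).y - innerMap Pw g (s n).x‖ ^ 2)
    (by positivity) (by positivity) (by positivity) (by positivity) (by positivity)
    (by positivity) hCβ (by positivity) (fun n => hr.abs_objective_le _)
    (fun n => by positivity) (fun n => by positivity) (fun n => by positivity)
    (fun n => by positivity) (fun n => ?_) (fun n => ?_) ?_ (fun n => ?_) hT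
  · exact norm_gradient_sq_le_of_step hCα (hroot n) hε hD0 hL0 (hx n) (hden (n + 1))
      (hr.norm_gradient_objective_le hMg _)
      (hr.objective_remainder hMf hMg hLf hLg (s n).x (s (n + 1)).x)
  · have h1 := norm_add_sq_le ((s (n + 1)).m - d n)
      (d n - gradient (objective Pv Pw f g) (s n).x)
    rw [sub_add_sub_cancel] at h1
    have h2 := norm_direction_sub_gradient_sq_le (Pv := Pv) (A := A) (S := S) hr hMf hMg
      (n + 1) (s n) ω
    -- The momentum differs from the fresh direction only by γ₁ times a bounded vector, and γ₁
    -- decays geometrically.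
    have h3 : (s (n + 1)).m - d n = A.γ₁ (n + 1) • ((s n).m - d n) := by
      rw [hm]
      module
    have hγ : A.γ₁ (n + 1) = Cγ * μ ^ (n + 1) := by rw [hA]; rfl
    have h4 : ‖(s (n + 1)).m - d n‖ ^ 2 ≤ (M + D₀) ^ 2 * Cγ ^ 2 * aμ * rate n := by
      rw [h3, norm_smul, mul_pow, Real.norm_eq_abs, sq_abs, hγ]
      have h5 : ‖(s n).m - d n‖ ≤ M + D₀ := (norm_sub_le _ _).trans (add_le_add (hmb n) (hdb n))
      have h6 : (μ ^ (n + 1)) ^ 2 ≤ aμ * rate n := by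
        refine le_trans ?_ (hμr n)
        have := pow_le_one₀ (n := n + 1) hμ.le hμ'.le
        nlinarith [pow_pos hμ (n + 1)]
      calc _ = ‖(s n).m - d n‖ ^ 2 * Cγ ^ 2 * (μ ^ (n + 1)) ^ 2 := by ring
        _ ≤ (M + D₀) ^ 2 * Cγ ^ 2 * (aμ * rate n) := by gcongr
        _ = _ := by ring
    simp only [c₄, c₅]
    linarith
  · change ‖(0 : EuclideanSpace ℝ (Fin q)) - innerMap Pw g x₁‖ ^ 2 ≤ R ^ 2
    rw [zero_sub, norm_neg]
    gcongr
  · have hz : (s (n + 1)).z = (1 - 1 / Cβ) • (s n).x + (1 / Cβ) • (s (n + 1)).x := by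
      rw [hstep, step_z, hA]
      rfl
    have hy : (s (n + 1)).y = (1 - Cβ) • (s n).y
        + Cβ • valMean A g S (n + 1) (s (n + 1)).z ω := by
      rw [hstep, step_y, hA]
      rfl
    refine (norm_tracking_sq_le hCβ hCβ' (hr.innerMap_remainder hMg hLg) hz hy).trans ?_
    have hb0 : 0 < fifthRoot (n + 1) := fifthRoot_pos (Nat.succ_pos n)
    have h1 : ‖(s (n + 1)).x - (s n).x‖ ^ 2 ≤ (Cα / fifthRoot (n + 1) / ε) ^ 2 * M ^ 2 :=
      (norm_step_le (by positivity) hε (hx n)).trans (by gcongr; exact hmb (n + 1))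
    -- The step length is O(t^(-1/5)), so its fourth power has the rate t^(-4/5).
    have h2 : (‖(s (n + 1)).x - (s n).x‖ ^ 2) ^ 2 ≤ (Cα / ε) ^ 4 * M ^ 4 * rate n := by
      calc _ ≤ ((Cα / fifthRoot (n + 1) / ε) ^ 2 * M ^ 2) ^ 2 := by gcongr
        _ = _ := by
          rw [rate]
          field_simp
    have h3 : 2 * (Lg * (1 / Cβ + 1) / Cβ) ^ 2 * (‖(s (n + 1)).x - (s n).x‖ ^ 2) ^ 2
        ≤ c₆ * rate n := by
      calc _ ≤ 2 * (Lg * (1 / Cβ + 1) / Cβ) ^ 2 * ((Cα / ε) ^ 4 * M ^ 4 * rate n) := by gcongr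
        _ = _ := by ring
    linarith

/-! ### Expected sampling errors and the bound in expectation. -/

section NoiseMoments

variable {p q : ℕ} {Ω V W : Type u} [mΩ : MeasurableSpace Ω] [mV : MeasurableSpace V]
  [mW : MeasurableSpace W] {P : Measure Ω} {Pv : Measure V} {Pw : Measure W}
  {A : Params} {f : V → EuclideanSpace ℝ (Fin q) → ℝ}
  {g : W → EuclideanSpace ℝ (Fin p) → EuclideanSpace ℝ (Fin q)} {Bf Mf Lf Mg Lg : ℝ}
  {S : Samples Ω V W} {σ₁ σ₂ σ₃ : ℝ}

theorem aestronglyMeasurable_gradMean_sub [IsProbabilityMeasure Pv]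
    (h : UnbiasedBoundedVariance P Pv Pw f g S σ₁ σ₂ σ₃)
    (hr : Regular Pw f g Bf Mf Lf Mg Lg) (x₁ : EuclideanSpace ℝ (Fin p)) (n : ℕ) :
    AEStronglyMeasurable (fun ω => gradMean A f S (n + 1) (run A f g S x₁ ω n).y ω
      - meanGrad Pv f (run A f g S x₁ ω n).y) P := by
  have hc : Continuous (meanGrad Pv f) := (LipschitzWith.of_dist_le' (K := Lf) fun y₁ y₂ => by
    simpa [dist_eq_norm] using hr.norm_meanGrad_sub_le (Pv := Pv) y₁ y₂).continuous
  have hy := (h.measurableState (A := A) hr x₁ n).y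
  exact ((measurable_gradMean hr (h.measurable_grad (n + 1)) hy).sub
    (hc.measurable.comp hy)).aestronglyMeasurable

theorem aestronglyMeasurable_valMean_sub [IsProbabilityMeasure Pw]
    (h : UnbiasedBoundedVariance P Pv Pw f g S σ₁ σ₂ σ₃)
    (hr : Regular Pw f g Bf Mf Lf Mg Lg) (x₁ : EuclideanSpace ℝ (Fin p)) (n : ℕ) :
    AEStronglyMeasurable (fun ω => valMean A g S (n + 1) (run A f g S x₁ ω (n + 1)).z ω
      - innerMap Pw g (run A f g S x₁ ω (n + 1)).z) P := by
  have hc : Continuous (innerMap Pw g) := (LipschitzWith.of_dist_le' (K := Mg) fun y₁ y₂ => by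
    simpa [dist_eq_norm] using hr.norm_innerMap_sub_le y₁ y₂).continuous
  have hz := h.measurable_z (A := A) hr x₁ n
  exact ((measurable_valMean hr (h.measurable_val (n + 1)) hz).sub
    (hc.measurable.comp hz)).aestronglyMeasurable

theorem measurable_jacMean_sub [IsProbabilityMeasure Pw]
    (h : UnbiasedBoundedVariance P Pv Pw f g S σ₁ σ₂ σ₃)
    (hr : Regular Pw f g Bf Mf Lf Mg Lg) (hMg : 0 ≤ Mg) (x₁ : EuclideanSpace ℝ (Fin p)) (n : ℕ) :
    Measurable (fun ω => jacMean A g S (n + 1) (run A f g S x₁ ω n).x ω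
      - meanJac Pw g (run A f g S x₁ ω n).x) := by
  have : SecondCountableTopology (EuclideanSpace ℝ (Fin p) →L[ℝ] EuclideanSpace ℝ (Fin q)) := by
    have := FiniteDimensional.proper ℝ (EuclideanSpace ℝ (Fin p) →L[ℝ] EuclideanSpace ℝ (Fin q))
    infer_instance
  have hc : Continuous (meanJac Pw g) := (LipschitzWith.of_dist_le' (K := Lg) fun y₁ y₂ => by
    simpa [dist_eq_norm] using hr.norm_meanJac_sub_le hMg y₁ y₂).continuous
  have hx := (h.measurableState (A := A) hr x₁ n).x
  exact (measurable_jacMean hr (h.measurable_jac (n + 1)) hx).sub (hc.measurable.comp hx)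

theorem jacMean_sub_moment [IsProbabilityMeasure P] [IsProbabilityMeasure Pw]
    (h : UnbiasedBoundedVariance P Pv Pw f g S σ₁ σ₂ σ₃)
    (hr : Regular Pw f g Bf Mf Lf Mg Lg) (hMg : 0 ≤ Mg) (x₁ : EuclideanSpace ℝ (Fin p)) (n : ℕ)
    (hK : 0 < A.K₁ (n + 1)) :
    Integrable (fun ω => ‖jacMean A g S (n + 1) (run A f g S x₁ ω n).x ω
      - meanJac Pw g (run A f g S x₁ ω n).x‖ ^ 2) P ∧
    ∫ ω, ‖jacMean A g S (n + 1) (run A f g S x₁ ω n).x ω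
      - meanJac Pw g (run A f g S x₁ ω n).x‖ ^ 2 ∂P ≤ p * σ₂ ^ 2 / A.K₁ (n + 1) := by
  have hm := measurable_jacMean_sub (A := A) h hr hMg x₁ n
  have hme i : AEStronglyMeasurable (fun ω => (jacMean A g S (n + 1) (run A f g S x₁ ω n).x ω
      - meanJac Pw g (run A f g S x₁ ω n).x) (EuclideanSpace.single i 1)) P :=
    ((ContinuousLinearMap.apply ℝ (EuclideanSpace ℝ (Fin q))
      (EuclideanSpace.single i (1 : ℝ))).continuous.measurable.comp hm).aestronglyMeasurable
  have hl i := lintegral_jacMean_sub_apply_le (A := A) h hr hMg x₁ n hK i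
  have hi i := integrable_norm_sq_of_lintegral_le (hme i) (hl i)
  have hint : Integrable (fun ω => ‖jacMean A g S (n + 1) (run A f g S x₁ ω n).x ω
      - meanJac Pw g (run A f g S x₁ ω n).x‖ ^ 2) P :=
    (integrable_finsetSum Finset.univ fun i _ => hi i).mono'
      (hm.norm.pow_const 2).aestronglyMeasurable (Eventually.of_forall fun ω => by
        rw [Real.norm_of_nonneg (by positivity)]
        exact norm_sq_le_sum_norm_sq_apply _)
  refine ⟨hint, ?_⟩
  calc _ ≤ ∫ ω, ∑ i, ‖(jacMean A g S (n + 1) (run A f g S x₁ ω n).x ω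
        - meanJac Pw g (run A f g S x₁ ω n).x) (EuclideanSpace.single i 1)‖ ^ 2 ∂P :=
        integral_mono hint (integrable_finsetSum Finset.univ fun i _ => hi i)
          fun ω => norm_sq_le_sum_norm_sq_apply _
    _ ≤ ∑ i : Fin p, σ₂ ^ 2 / A.K₁ (n + 1) := by
        rw [integral_finsetSum _ fun i _ => hi i]
        exact Finset.sum_le_sum fun i _ =>
          integral_norm_sq_le_of_lintegral_le (by positivity) (hme i) (hl i)
    _ = _ := by simp [mul_div_assoc]

end NoiseMoments

/-- The expected sum of the squared gradient norms along `T` iterations is of order `T^(1/5)`. -/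
theorem exists_expected_sum_bound (p q : ℕ) {Bf Mf Lf Mg Lg σ₁ σ₂ σ₃ R ε Cα Cβ C₁ C₂ C₃ Cγ μ : ℝ}
    (hMf : 0 ≤ Mf) (hLf : 0 ≤ Lf) (hMg : 0 ≤ Mg) (hLg : 0 ≤ Lg)
    (hε : 0 < ε) (hCα : 0 < Cα) (hCβ : 0 < Cβ) (hCβ' : Cβ < 1)
    (hC₁ : 0 < C₁) (hC₂ : 0 < C₂) (hC₃ : 0 < C₃) (hCγ : 0 < Cγ) (hμ : 0 < μ) (hμ' : μ < 1) :
    ∃ c : ℝ, ∀ (Ω V W : Type u) [MeasurableSpace Ω] [MeasurableSpace V] [MeasurableSpace W]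
      (P : Measure Ω) (Pv : Measure V) (Pw : Measure W)
      [IsProbabilityMeasure P] [IsProbabilityMeasure Pv] [IsProbabilityMeasure Pw]
      (f : V → EuclideanSpace ℝ (Fin q) → ℝ)
      (g : W → EuclideanSpace ℝ (Fin p) → EuclideanSpace ℝ (Fin q))
      (S : Samples Ω V W) (x₁ : EuclideanSpace ℝ (Fin p)) (A : Params),
      A = schedule ε Cα Cβ C₁ C₂ C₃ Cγ μ →
      Regular Pw f g Bf Mf Lf Mg Lg → UnbiasedBoundedVariance P Pv Pw f g S σ₁ σ₂ σ₃ →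
      ‖innerMap Pw g x₁‖ ≤ R → ∀ T : ℕ, 0 < T →
      ∫ ω, ∑ n ∈ Finset.range T, ‖gradient (objective Pv Pw f g) (run A f g S x₁ ω n).x‖ ^ 2 ∂P
        ≤ c * fifthRoot T := by
  obtain ⟨a, b, hb, hab⟩ := exists_pathwise_bound.{u} p q (Bf := Bf) (R := R) C₁ C₂ C₃ hMf hLf hMg
    hLg hε hCα hCβ hCβ' hCγ hμ hμ'
  set ν := p * σ₂ ^ 2 / C₁ + σ₁ ^ 2 / C₂ + σ₃ ^ 2 / C₃ with hν
  have hν0 : 0 ≤ ν := by positivity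
  refine ⟨a + b * (ν * 5), ?_⟩
  intro Ω V W _ _ _ P Pv Pw _ _ _ f g S x₁ A hA hr hS hR T hT
  have hK₁ n : 0 < A.K₁ (n + 1) := by rw [hA]; exact ceil_pos hC₁ n
  have hK₂ n : 0 < A.K₂ (n + 1) := by rw [hA]; exact ceil_pos hC₂ n
  have hK₃ n : 0 < A.K₃ (n + 1) := by rw [hA]; exact ceil_pos hC₃ n
  have h1 n := jacMean_sub_moment (A := A) hS hr hMg x₁ n (hK₁ n)
  have hl2 n := lintegral_gradMean_sub_le (A := A) hS hr x₁ n (hK₂ n)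
  have hl3 n := lintegral_valMean_sub_le (A := A) hS hr x₁ n (hK₃ n)
  have hm2 n := aestronglyMeasurable_gradMean_sub (A := A) hS hr x₁ n
  have hm3 n := aestronglyMeasurable_valMean_sub (A := A) hS hr x₁ n
  have hi2 n := integrable_norm_sq_of_lintegral_le (hm2 n) (hl2 n)
  have hi3 n := integrable_norm_sq_of_lintegral_le (hm3 n) (hl3 n)
  have h2 n := integral_norm_sq_le_of_lintegral_le (by positivity) (hm2 n) (hl2 n)
  have h3 n := integral_norm_sq_le_of_lintegral_le (by positivity) (hm3 n) (hl3 n)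
  have hd1 n : p * σ₂ ^ 2 / A.K₁ (n + 1) ≤ p * σ₂ ^ 2 / C₁ * rate n := by
    rw [hA]; exact div_ceil_le hC₁ (by positivity) n
  have hd2 n : σ₁ ^ 2 / A.K₂ (n + 1) ≤ σ₁ ^ 2 / C₂ * rate n := by
    rw [hA]; exact div_ceil_le hC₂ (by positivity) n
  have hd3 n : σ₃ ^ 2 / A.K₃ (n + 1) ≤ σ₃ ^ 2 / C₃ * rate n := by
    rw [hA]; exact div_ceil_le hC₃ (by positivity) n
  have hi n := ((h1 n).1.fun_add (hi2 n)).fun_add (hi3 n)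
  have hsum := integrable_finsetSum (Finset.range T) fun n _ => hi n
  have hnoise n : ∫ ω, (‖jacMean A g S (n + 1) (run A f g S x₁ ω n).x ω
              - meanJac Pw g (run A f g S x₁ ω n).x‖ ^ 2
            + ‖gradMean A f S (n + 1) (run A f g S x₁ ω n).y ω
              - meanGrad Pv f (run A f g S x₁ ω n).y‖ ^ 2
            + ‖valMean A g S (n + 1) (run A f g S x₁ ω (n + 1)).z ω
              - innerMap Pw g (run A f g S x₁ ω (n + 1)).z‖ ^ 2) ∂P ≤ ν * rate n := by
    rw [integral_add ((h1 n).1.fun_add (hi2 n)) (hi3 n), integral_add (h1 n).1 (hi2 n)]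
    rw [hν, add_mul, add_mul]
    exact add_le_add (add_le_add ((h1 n).2.trans (hd1 n)) ((h2 n).trans (hd2 n)))
      ((h3 n).trans (hd3 n))
  -- This form of monotonicity asks for integrability of the dominating function only.
  refine (integral_mono_of_nonneg (Eventually.of_forall fun ω => by positivity)
    ((integrable_const (a * fifthRoot T)).fun_add (hsum.const_mul b))
    (Eventually.of_forall fun ω => hab Ω V W Pv Pw f g S x₁ A hA hr hR ω T hT)).trans ?_
  rw [integral_add (integrable_const _) (hsum.const_mul b), integral_const_mul b,
    integral_finsetSum _ fun n _ => hi n]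
  simp only [integral_const, probReal_univ, one_smul]
  calc _ ≤ a * fifthRoot T + b * ∑ n ∈ Finset.range T, ν * rate n := by
        gcongr with n _
        exact hnoise n
    _ ≤ a * fifthRoot T + b * (ν * (5 * fifthRoot T)) := by
        rw [← Finset.mul_sum]
        gcongr
        exact sum_rate_le T
    _ = _ := by ring

/-! ### The random output index and the final choice of T. -/

theorem isProbabilityMeasure_uniformOn_Icc {T : ℕ} (hT : 0 < T) :
    IsProbabilityMeasure (uniformOn (Set.Icc 1 T)) :=
  isProbabilityMeasure_uniformOn (Set.finite_Icc 1 T) (Set.nonempty_Icc.2 hT)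

theorem integral_uniformOn_Icc (h : ℕ → ℝ) (T : ℕ) :
    ∫ t, h t ∂(uniformOn (Set.Icc 1 T)) = (T : ℝ)⁻¹ * ∑ n ∈ Finset.range T, h (n + 1) := by
  have hs : Set.Icc 1 T = ((Finset.Icc 1 T : Finset ℕ) : Set ℕ) := by simp
  rw [uniformOn, ProbabilityTheory.cond, integral_smul_measure, hs, setIntegral_finset]
  · have hsum : ∑ n ∈ Finset.range T, h (n + 1) = ∑ t ∈ Finset.Icc 1 T, h t := by
      rw [Finset.range_eq_Ico, Finset.sum_Ico_add' h 0 T 1]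
      congr 1
    rw [Measure.count_apply_finset, hsum]
    simp [Measure.real]
  · rw [← Set.biUnion_of_singleton ((Finset.Icc 1 T : Finset ℕ) : Set ℕ)]
    exact integrableOn_finset_iUnion.2 fun t _ => by simp

end CAdam

theorem theorem1 (p q : ℕ)
    -- constants of the regularity and oracle assumptions, and a bound on `‖g(x₁)‖`
    (Bf Mf Lf Mg Lg σ₁ σ₂ σ₃ R : ℝ)
    -- constants of the algorithm
    (ε Cα Cβ C₁ C₂ C₃ Cγ μ : ℝ)
    (hε : 0 < ε) (hCα : 0 < Cα) (hCβ : 0 < Cβ) (hCβ' : Cβ < 1)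
    (hC₁ : 0 < C₁) (hC₂ : 0 < C₂) (hC₃ : 0 < C₃) (hCγ : 0 < Cγ) (hμ : 0 < μ) (hμ' : μ < 1) :
    ∃ C : ℝ, ∀ δ : ℝ, 0 < δ → δ < 1 → ∃ T : ℕ, 1 ≤ T ∧
      ((CAdam.schedule ε Cα Cβ C₁ C₂ C₃ Cγ μ).oracleCalls T : ℝ) ≤ C * δ ^ (-(9 / 4) : ℝ) ∧
      ∀ (Ω V W : Type u) [MeasurableSpace Ω] [MeasurableSpace V] [MeasurableSpace W]
        (P : MeasureTheory.Measure Ω) (Pv : MeasureTheory.Measure V)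
        (Pw : MeasureTheory.Measure W)
        [MeasureTheory.IsProbabilityMeasure P] [MeasureTheory.IsProbabilityMeasure Pv]
        [MeasureTheory.IsProbabilityMeasure Pw]
        (f : V → EuclideanSpace ℝ (Fin q) → ℝ)
        (g : W → EuclideanSpace ℝ (Fin p) → EuclideanSpace ℝ (Fin q))
        (S : CAdam.Samples Ω V W) (x₁ : EuclideanSpace ℝ (Fin p)),
        CAdam.Regular Pw f g Bf Mf Lf Mg Lg →
        CAdam.UnbiasedBoundedVariance P Pv Pw f g S σ₁ σ₂ σ₃ →
        ‖CAdam.innerMap Pw g x₁‖ ≤ R →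
        Differentiable ℝ (CAdam.objective Pv Pw f g) ∧
        MeasureTheory.Integrable
          (fun r => ‖gradient (CAdam.objective Pv Pw f g)
            (CAdam.output (CAdam.schedule ε Cα Cβ C₁ C₂ C₃ Cγ μ) f g S x₁ r)‖ ^ 2)
          (CAdam.totalMeasure P T) ∧
        ∫ r, ‖gradient (CAdam.objective Pv Pw f g)
            (CAdam.output (CAdam.schedule ε Cα Cβ C₁ C₂ C₃ Cγ μ) f g S x₁ r)‖ ^ 2
          ∂(CAdam.totalMeasure P T) ≤ δ := by
  obtain ⟨c₀, hc₀⟩ := CAdam.exists_expected_sum_bound.{u} p q (Bf := |Bf|) (σ₁ := σ₁) (σ₂ := σ₂)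
    (σ₃ := σ₃) (R := R) (abs_nonneg Mf) (abs_nonneg Lf) (abs_nonneg Mg) (abs_nonneg Lg)
    hε hCα hCβ hCβ' hC₁ hC₂ hC₃ hCγ hμ hμ'
  -- Nothing is known about the sign of `c₀`; the maximum makes c positive and gives c/δ ≥ 1, hence
  -- T ≥ 1.
  set c := max c₀ 1 with hc
  have hc1 : 1 ≤ c := le_max_right _ _
  have hc0 : 0 < c := by linarith
  refine ⟨(C₁ + C₂ + C₃ + 3) * (2 ^ (9 / 5 : ℝ) * c ^ (9 / 4 : ℝ)), fun δ hδ hδ' => ?_⟩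
  have hcδ : 1 ≤ c / δ := by
    rw [le_div_iff₀ hδ]
    linarith
  -- The average bound c T^(1/5)/T is at most δ exactly when T ≥ (c/δ)^(5/4).
  set τ := (c / δ) ^ (5 / 4 : ℝ) with hτ
  have hτ1 : 1 ≤ τ := Real.one_le_rpow hcδ (by norm_num)
  set T := ⌈τ⌉₊ with hT
  have hTτ : τ ≤ T := Nat.le_ceil τ
  have hT1 : 1 ≤ T := by exact_mod_cast hτ1.trans hTτ
  have hT0 : (0 : ℝ) < T := by exact_mod_cast hT1
  -- Rounding up costs at most a factor 2 because τ ≥ 1; this is the source of 2^(9/5) in the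
  -- constant.
  have hT2 : (T : ℝ) ≤ 2 * τ := by linarith [Nat.ceil_lt_add_one (by linarith : 0 ≤ τ)]
  refine ⟨T, hT1, ?_, ?_⟩
  · refine (CAdam.oracleCalls_le hC₁.le hC₂.le hC₃.le T).trans ?_
    rw [mul_assoc]
    gcongr
    calc (T : ℝ) ^ (9 / 5 : ℝ) ≤ (2 * τ) ^ (9 / 5 : ℝ) := by gcongr
      _ = 2 ^ (9 / 5 : ℝ) * (c / δ) ^ (9 / 4 : ℝ) := by
          rw [Real.mul_rpow (by norm_num) (by linarith), hτ, ← Real.rpow_mul (by positivity)]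
          norm_num
      _ = _ := by
          rw [Real.div_rpow hc0.le hδ.le, Real.rpow_neg hδ.le]
          ring
  intro Ω V W _ _ _ P Pv Pw _ _ _ f g S x₁ hr hS hR
  replace hr := hr.abs
  set A := CAdam.schedule ε Cα Cβ C₁ C₂ C₃ Cγ μ with hA
  have hMg := abs_nonneg Mg
  have hprob := CAdam.isProbabilityMeasure_uniformOn_Icc hT1
  have hcont := hr.continuous_gradient_objective (Pv := Pv) hMg (abs_nonneg Lf) (abs_nonneg Lg)
  have hmeas : Measurable (fun r : Ω × ℕ => ‖gradient (CAdam.objective Pv Pw f g)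
      (CAdam.output A f g S x₁ r)‖ ^ 2) := by
    refine measurable_from_prod_countable_left fun t => ?_
    exact ((hcont.measurable.comp (hS.measurableState hr x₁ (t - 1)).x).norm).pow_const 2
  have hint : MeasureTheory.Integrable (fun r : Ω × ℕ => ‖gradient (CAdam.objective Pv Pw f g)
      (CAdam.output A f g S x₁ r)‖ ^ 2) (CAdam.totalMeasure P T) := by
    have : MeasureTheory.IsProbabilityMeasure (CAdam.totalMeasure P T) := by
      unfold CAdam.totalMeasure
      infer_instance
    refine MeasureTheory.Integrable.of_bound hmeas.aestronglyMeasurable ((|Mg| * |Mf|) ^ 2)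
      (Filter.Eventually.of_forall fun r => ?_)
    rw [norm_pow, norm_norm]
    gcongr
    exact hr.norm_gradient_objective_le hMg _
  refine ⟨hr.differentiable_objective hMg, hint, ?_⟩
  rw [CAdam.totalMeasure, MeasureTheory.integral_prod _ hint]
  -- The output index t = n + 1 refers to the state after n iterations, so the uniform average
  -- becomes the sum over `Finset.range T` bounded above.
  simp only [CAdam.integral_uniformOn_Icc, CAdam.output, CAdam.iterate, Nat.add_sub_cancel]
  rw [MeasureTheory.integral_const_mul, inv_mul_le_iff₀ hT0]
  have hb := CAdam.fifthRoot_nonneg T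
  refine (hc₀ Ω V W P Pv Pw f g S x₁ A hA hr hS hR T hT1).trans ?_
  have hroot : c / δ ≤ CAdam.fifthRoot T ^ 4 := by
    rw [CAdam.fifthRoot_pow]
    calc c / δ = τ ^ (4 / 5 : ℝ) := by
          rw [hτ, ← Real.rpow_mul (by positivity)]
          norm_num
      _ ≤ _ := by
          push_cast
          gcongr
  calc c₀ * CAdam.fifthRoot T ≤ c * CAdam.fifthRoot T := by
        gcongr
        exact le_max_left _ _
    _ ≤ δ * CAdam.fifthRoot T ^ 4 * CAdam.fifthRoot T := by
        gcongr
        rwa [div_le_iff₀' hδ] at hroot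
    _ = (CAdam.fifthRoot T ^ 5) * δ := by ring
    _ = _ := by rw [CAdam.fifthRoot_pow_five]
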